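/- For an operad $\mathcal P$ in rational vector spaces with $\mathcal P(0)=0$ and $\mathcal P(1)=\mathbb Q e$, let $\widehat{\mathcal P}=\prod_n \mathcal P(n)_{\mathfrak S_n}$ (coinvariants), with the product $x\times y=\sum_{m\ge 1}\sum_{n_1,\dots,n_m\ge 1}\langle\gamma(\bar x_m;\bar y_{n_1},\dots,\bar y_{n_m})\rangle$, where bars denote arbitrary representatives, $\gamma$ is the operadic composition and $\langle\ \rangle$ the class in the coinvariants; let $\mathsf G_{\mathcal P}$ be the set of elements of $\widehat{\mathcal P}$ that are invertible for $\times$. Let $\mathrm{PreLie}$ be the operad spanned by labelled rooted trees: the composition substitutes trees for the vertices of a tree and sums over all ways of grafting the incoming edges of each replaced vertex onto vertices of the tree substituted for it. Let $\mathrm{As}$ be its quotient by the ideal spanned by the non-linear trees (a tree is linear if every vertex has at most one incoming edge), which is the associative operad, and let $\phi:\widehat{\mathrm{PreLie}}\to\widehat{\mathrm{As}}$ be the induced map. Let $\theta_n\in \mathrm{As}(n)_{\mathfrak S_n}$ be the class of the linear tree with $n$ vertices. In the completed free pre-Lie algebra on one generator $v$, which is identified with $\widehat{\mathrm{PreLie}}$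 ($v$ being the unit of the operad and $x\leftarrow y$ the operation given by the tree with two vertices, with $x$ at the root and $y$ above it), put $$\exp^*=\sum_{k\ge 1}\frac{v^{\leftarrow k}}{k!},\qquad v^{\leftarrow k}=((\cdots(v\leftarrow v)\leftarrow\cdots)\leftarrow v)\quad(k\text{ factors}).$$ Then: 1. $\times$ is associative with a two-sided unit on $\widehat{\mathrm{PreLie}}$ and on $\widehat{\mathrm{As}}$, and $\phi$ restricts to a group homomorphism $\mathsf G_{\mathrm{PreLie}}\to\mathsf G_{\mathrm{As}}$. 2. $\sum_n f_nx^n\mapsto\sum_n f_n\theta_n$ is a group isomorphism from the power series $f\in x\mathbb Q[[x]]$ with $f_1\ne 0$, under composition $f\circ g$, onto $\mathsf G_{\mathrm{As}}$. 3. $\exp^*$ belongs to $\mathsf G_{\mathrm{PreLie}}$; denote its unique inverse by $\log^*$. Under the isomorphism in 2, $\phi(\exp^*)$ corresponds to $\exp x-1$ and $\phi(\log^*)$ corresponds to $\log(1+x)$. 4. For every $n\ge 1$, the coefficient of the linear tree with $n$ vertices in $\exp^*$ is $1/n!$. -/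

import Mathlib

noncomputable section

/-- A labelled rooted tree, with vertex set `I`, encoded by its root and its parent function (the edge leaving
a vertex `i ≠ root` goes to `parent i`); by convention the parent of the root is the root itself.
The incoming edges of a vertex `p` are the vertices `i ≠ root` with `parent i = p`. -/
@[ext] structure LabelledTree (I : Type) where
  root : I
  parent : I → I
  parent_root : parent root = root
  reaches_root : ∀ i, ∃ k : ℕ, parent^[k] i = root

namespace LabelledTree

variable {I I' : Type}

instance [Finite I] : Finite (LabelledTree I) :=
  Finite.of_injective (fun T : LabelledTree I => (T.root, T.parent)) fun T T' h => by
    ext1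
    · exact congrArg Prod.fst h
    · exact congrArg Prod.snd h

instance [Finite I] : Fintype (LabelledTree I) := Fintype.ofFinite _

/-- The relabelling of a tree along a bijection of vertex sets. -/
def relabel (e : I ≃ I') (T : LabelledTree I) : LabelledTree I' where
  root := e T.root
  parent i := e (T.parent (e.symm i))
  parent_root := by simp [T.parent_root]
  reaches_root i := by
    obtain ⟨k, hk⟩ := T.reaches_root (e.symm i)
    refine ⟨k, ?_⟩
    have key : ∀ (n : ℕ) (j : I),
        (fun i => e (T.parent (e.symm i)))^[n] (e j) = e (T.parent^[n] j) := by
      intro n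
      induction n with
      | zero => intro j; rfl
      | succ n ih => intro j; simp [Function.iterate_succ_apply, ih]
    have := key k (e.symm i)
    rw [hk, e.apply_symm_apply] at this
    exact this

theorem relabel_trans {I'' : Type} (e : I ≃ I') (e' : I' ≃ I'') (T : LabelledTree I) :
    (T.relabel e).relabel e' = T.relabel (e.trans e') := rfl

/-- Relabelling along a bijection, as a bijection of sets of trees. -/
def relabelEquiv (e : I ≃ I') : LabelledTree I ≃ LabelledTree I' where
  toFun := relabel e
  invFun := relabel e.symm
  left_inv T := by rw [relabel_trans]; ext <;> simp [relabel]
  right_inv T := by rw [relabel_trans]; ext <;> simp [relabel]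

/-- A tree is linear if every vertex has at most one incoming edge. -/
def IsLinear (T : LabelledTree I) : Prop :=
  ∀ i j : I, i ≠ T.root → j ≠ T.root → T.parent i = T.parent j → i = j

/-- The choices of attaching vertices when a tree `S p` is substituted for every vertex `p` of `T`:
for every incoming edge of every vertex `p` of `T` (that is, for every vertex `i ≠ root`, with
`p = parent i`), a vertex of the tree substituted for `p`. -/
abbrev AttachMap (T : LabelledTree I) (J : I → Type) : Type :=
  ∀ i : {i : I // i ≠ T.root}, J (T.parent i)

open Classical in
/-- The parent function of the tree obtained by replacing every vertex `i` of `T` by `S i`. -/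
def graftParent (T : LabelledTree I) {J : I → Type} (S : ∀ i, LabelledTree (J i))
    (f : T.AttachMap J) : (Σ i, J i) → Σ i, J i := fun a =>
  if a.2 = (S a.1).root then
    if h : a.1 = T.root then a else ⟨T.parent a.1, f ⟨a.1, h⟩⟩
  else ⟨a.1, (S a.1).parent a.2⟩

/-- Replace every vertex `i` of `T` by the tree `S i`, the subtrees of `T` attached to `i` being
grafted back on vertices of `S i` according to `f`. -/
def graft (T : LabelledTree I) {J : I → Type} (S : ∀ i, LabelledTree (J i))
    (f : T.AttachMap J) : LabelledTree (Σ i, J i) where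
  root := ⟨T.root, (S T.root).root⟩
  parent := T.graftParent S f
  parent_root := by simp [graftParent]
  reaches_root := by
    have step : ∀ i (j : J i), ∃ k : ℕ, (T.graftParent S f)^[k] ⟨i, j⟩ = ⟨i, (S i).root⟩ := by
      intro i j
      obtain ⟨k, hk⟩ := (S i).reaches_root j
      induction k generalizing j with
      | zero => exact ⟨0, by simpa using hk⟩
      | succ k ih =>
        by_cases hj : j = (S i).root
        · exact ⟨0, by simp [hj]⟩
        · obtain ⟨l, hl⟩ := ih ((S i).parent j) hk
          refine ⟨l + 1, ?_⟩
          rw [Function.iterate_succ_apply, ← hl]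
          simp [graftParent, hj]
    rintro ⟨i, j⟩
    obtain ⟨k, hk⟩ := T.reaches_root i
    induction k generalizing i with
    | zero =>
      obtain rfl : i = T.root := hk
      exact step _ j
    | succ k ih =>
      by_cases hi : i = T.root
      · subst hi
        exact step _ j
      · obtain ⟨l, hl⟩ := step i j
        obtain ⟨l', hl'⟩ := ih (T.parent i) (f ⟨i, hi⟩) hk
        refine ⟨l' + (l + 1), ?_⟩
        rw [Function.iterate_add_apply, Function.iterate_succ_apply', hl, ← hl']
        simp [graftParent, hi]

theorem IsLinear.of_relabel {e : I ≃ I'} {T : LabelledTree I} (h : (T.relabel e).IsLinear) :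
    T.IsLinear := by
  intro i j hi hj hij
  have := h (e i) (e j) (by simpa [relabel] using hi) (by simpa [relabel] using hj)
    (by simp [relabel, hij])
  exact e.injective this

/-- The tree with one vertex. -/
def point : LabelledTree Unit := ⟨(), id, rfl, fun _ => ⟨0, rfl⟩⟩

/-- The tree with two vertices, with root `0`. -/
def edge : LabelledTree (Fin 2) := ⟨0, fun _ => 0, rfl, fun _ => ⟨1, rfl⟩⟩

/-- The linear tree `0 ← 1 ← ⋯ ← n` with `n + 1` vertices. -/
def ladder (n : ℕ) : LabelledTree (Fin (n + 1)) where
  root := 0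
  parent i := ⟨(i : ℕ) - 1, by omega⟩
  parent_root := rfl
  reaches_root i := by
    obtain ⟨i, hi⟩ := i
    induction i with
    | zero => exact ⟨0, rfl⟩
    | succ i ih =>
      obtain ⟨k, hk⟩ := ih (by omega)
      exact ⟨k + 1, hk⟩

end LabelledTree

/-- The structure maps of a symmetric operad in rational vector spaces, in coordinate-free form:
a space `obj I` of operations with inputs labelled by `I` (so that the space of `n`-ary operations
is `obj (Fin n)`), the action of bijections, the unit, and the composition `γ(x; (y_i))`, whose
inputs are labelled by the disjoint union of the label sets of the `y_i`. -/
structure OperadData where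
  obj : Type → Type
  [addCommGroup : ∀ I, AddCommGroup (obj I)]
  [module : ∀ I, Module ℚ (obj I)]
  map : ∀ {I J : Type}, (I ≃ J) → obj I →ₗ[ℚ] obj J
  unit : obj Unit
  comp : ∀ {I : Type} [Fintype I] {J : I → Type} [∀ i, Fintype (J i)],
    obj I → (∀ i, obj (J i)) → obj (Σ i, J i)

namespace OperadData

attribute [instance] OperadData.addCommGroup OperadData.module

variable (P : OperadData)

/-- The subspace of `P(n)` spanned by the differences `σ x - x`. -/
def coinvKer (n : ℕ) : Submodule ℚ (P.obj (Fin n)) :=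
  Submodule.span ℚ {z | ∃ (σ : Equiv.Perm (Fin n)) (x : P.obj (Fin n)), z = P.map σ x - x}

/-- The space of coinvariants of `P(n)` under the symmetric group. -/
abbrev Coinv (n : ℕ) : Type := P.obj (Fin n) ⧸ P.coinvKer n

/-- The product over `n` of the spaces of coinvariants. It is the completion of the free
`P`-algebra on one generator. -/
abbrev Completion : Type := ∀ n : ℕ, P.Coinv n

variable {P}

/-- The class in degree `N` of an operation with inputs labelled by a finite set `I` (it is zero if
`I` does not have `N` elements). -/
def cls {I : Type} [Fintype I] (N : ℕ) (x : P.obj I) : P.Coinv N :=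
  open Classical in
  if h : Fintype.card I = N then
    Submodule.Quotient.mk (P.map (Fintype.equivFinOfCardEq h) x)
  else 0

/-- A chosen representative of a class of coinvariants. -/
def rep {n : ℕ} (x : P.Coinv n) : P.obj (Fin n) :=
  Function.surjInv (Submodule.mkQ_surjective (P.coinvKer n)) x

/-- The structure of a `P`-algebra on the completed free `P`-algebra on one generator: the operation
`p ∈ P(m)` sends `(z_1, …, z_m)` to the sum over `n_1, …, n_m ≥ 1` of the classes of
`γ(p; z_{1,n_1}, …, z_{m,n_m})`. Only the indices `n_i ≤ N` contribute to degree `N`. -/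
def act {m : ℕ} (p : P.obj (Fin m)) (z : Fin m → P.Completion) : P.Completion := fun N =>
  ∑ n ∈ Fintype.piFinset (fun _ : Fin m => Finset.Icc 1 N),
    cls N (P.comp p fun i => rep (z i (n i)))

/-- The product `x × y`, the sum over `m ≥ 1` and `n_1, …, n_m ≥ 1` of the classes of
`γ(x_m; y_{n_1}, …, y_{n_m})`. Only the indices `m ≤ N` contribute to degree `N`. -/
def prod (x y : P.Completion) : P.Completion := fun N =>
  ∑ m ∈ Finset.Icc 1 N, act (rep (x m)) (fun _ => y) N

variable (P) in
/-- The image of the unit of the operad. It is also the generator of the free `P`-algebra. -/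
def one : P.Completion := fun N => cls N P.unit

variable (P) in
/-- The product is associative with two-sided unit `one`. -/
def IsMonoid : Prop :=
  (∀ x y z : P.Completion, prod (prod x y) z = prod x (prod y z)) ∧
    ∀ x : P.Completion, prod P.one x = x ∧ prod x P.one = x

/-- `y` is a two-sided inverse of `x`. -/
def IsInverse (x y : P.Completion) : Prop := prod x y = P.one ∧ prod y x = P.one

variable (P) in
/-- The group of the operad `P`: the invertible elements of the completion. -/
def G : Set P.Completion := {x | ∃ y, IsInverse x y}

end OperadData

/-- The pre-Lie operad: linear combinations of labelled rooted trees; the composition of trees is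
the sum over all choices of attaching vertices, extended multilinearly. -/
def PreLie : OperadData where
  obj I := LabelledTree I →₀ ℚ
  map e := Finsupp.lmapDomain ℚ ℚ (LabelledTree.relabel e)
  unit := Finsupp.single LabelledTree.point 1
  comp {I} _ {J} _ x y :=
    open Classical in
    ∑ T : LabelledTree I, ∑ S : ∀ i, LabelledTree (J i),
      (x T * ∏ i, y i (S i)) • ∑ f : T.AttachMap J, Finsupp.single (T.graft S f) 1

namespace PreLie

open Classical in
/-- The sum of the coefficients of all labelled trees isomorphic to `T`. -/
def treeSum {n : ℕ} (T : LabelledTree (Fin n)) : (LabelledTree (Fin n) →₀ ℚ) →ₗ[ℚ] ℚ :=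
  ∑ T' with ∃ σ : Equiv.Perm (Fin n), T' = T.relabel σ, Finsupp.lapply T'

theorem treeSum_relabel {n : ℕ} (T : LabelledTree (Fin n)) (σ : Equiv.Perm (Fin n))
    (x : LabelledTree (Fin n) →₀ ℚ) :
    treeSum T (Finsupp.lmapDomain ℚ ℚ (LabelledTree.relabel σ) x) = treeSum T x := by
  rw [treeSum, LinearMap.sum_apply, LinearMap.sum_apply]
  symm
  refine Finset.sum_equiv (LabelledTree.relabelEquiv σ) (fun T' => ?_) (fun T' _ => ?_)
  · simp only [Finset.mem_filter, Finset.mem_univ, true_and]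
    constructor
    · rintro ⟨τ, rfl⟩
      exact ⟨τ.trans σ, rfl⟩
    · rintro ⟨τ, hτ⟩
      exact ⟨τ.trans σ.symm, (LabelledTree.relabelEquiv σ).injective (by
        rw [hτ]; ext <;> simp [LabelledTree.relabelEquiv, LabelledTree.relabel])⟩
  · exact (Finsupp.mapDomain_apply (LabelledTree.relabelEquiv σ).injective x T').symm

/-- The coefficient of (the isomorphism class of) a tree `T` in a class of coinvariants: the sum of
the coefficients of all labelled trees isomorphic to `T`. -/
def treeCoeff {n : ℕ} (T : LabelledTree (Fin n)) : PreLie.Coinv n →ₗ[ℚ] ℚ :=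
  Submodule.liftQ (PreLie.coinvKer n) (treeSum T) (by
    rw [OperadData.coinvKer, Submodule.span_le]
    rintro _ ⟨σ, x, rfl⟩
    exact ((treeSum T).map_sub _ _).trans (sub_eq_zero.mpr (treeSum_relabel T σ x)))

/-- The pre-Lie product `x ← y` on the completed free pre-Lie algebra on one generator. -/
def bracket (x y : PreLie.Completion) : PreLie.Completion :=
  OperadData.act (P := PreLie) (Finsupp.single LabelledTree.edge 1) ![x, y]

/-- The iterate `v^{← (k+1)} = ((v ← v) ← ⋯) ← v` with `k + 1` factors, `v` the generator. -/
def iter : ℕ → PreLie.Completion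
  | 0 => PreLie.one
  | k + 1 => bracket (iter k) PreLie.one

/-- The sum over `k ≥ 1` of `v^{← k} / k!`. Since `v^{← k}` is homogeneous of degree `k`, only the
indices `k ≤ N` contribute to degree `N`. -/
def expStar : PreLie.Completion := fun N =>
  ∑ k ∈ Finset.range N, (1 / (Nat.factorial (k + 1) : ℚ)) • iter k N

/-- The subspace spanned by the labelled trees that are not linear. -/
def nonLinear (I : Type) : Submodule ℚ (PreLie.obj I) :=
  Submodule.span ℚ {x | ∃ T : LabelledTree I, ¬ T.IsLinear ∧ x = Finsupp.single T (1 : ℚ)}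

theorem nonLinear_le_comap {I J : Type} (e : I ≃ J) :
    nonLinear I ≤ (nonLinear J).comap (PreLie.map e) := by
  rw [nonLinear, Submodule.span_le]
  rintro _ ⟨T, hT, rfl⟩
  refine Submodule.subset_span ⟨T.relabel e, fun h => hT h.of_relabel, ?_⟩
  exact Finsupp.mapDomain_single

end PreLie

/-- The associative operad, as the quotient of the pre-Lie operad by the ideal spanned by the trees
that are not linear; the composition is computed on representatives. -/
def As : OperadData where
  obj I := PreLie.obj I ⧸ PreLie.nonLinear I
  map e := Submodule.mapQ _ _ (PreLie.map e) (PreLie.nonLinear_le_comap e)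
  unit := Submodule.Quotient.mk PreLie.unit
  comp x y := Submodule.Quotient.mk (PreLie.comp
    (Function.surjInv (Submodule.mkQ_surjective _) x)
    fun i => Function.surjInv (Submodule.mkQ_surjective _) (y i))

namespace As

/-- The quotient map of operads. -/
def quot (I : Type) : PreLie.obj I →ₗ[ℚ] As.obj I := (PreLie.nonLinear I).mkQ

theorem coinvKer_le_comap (n : ℕ) :
    PreLie.coinvKer n ≤ (As.coinvKer n).comap (quot (Fin n)) := by
  rw [OperadData.coinvKer, Submodule.span_le]
  rintro _ ⟨σ, x, rfl⟩
  refine Submodule.subset_span ⟨σ, quot _ x, ?_⟩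
  rw [map_sub]
  rfl

/-- The map of completions induced by the quotient map. -/
def phi (x : PreLie.Completion) : As.Completion := fun n =>
  Submodule.mapQ _ _ (quot (Fin n)) (coinvKer_le_comap n) (x n)

/-- The class of the linear tree with `n` vertices, `n ≥ 1` (and `0` for `n = 0`). -/
def theta : (n : ℕ) → As.Coinv n
  | 0 => 0
  | n + 1 => Submodule.Quotient.mk (quot _ (Finsupp.single (LabelledTree.ladder n) 1))

/-- The linear map sending a power series `∑ f_n x^n` without constant term to `∑ f_n θ_n`. -/
def ofSeries (f : PowerSeries ℚ) : As.Completion := fun n => PowerSeries.coeff n f • theta n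

end As

/-- The formal power series in `xℚ[[x]]` that are invertible for composition. -/
def invertibleSeries : Set (PowerSeries ℚ) :=
  {f | PowerSeries.constantCoeff f = 0 ∧ PowerSeries.coeff 1 f ≠ 0}

end

/-!
For an operad `P` without operations of arity zero, the completion `∏ P(n)_{S_n}` is an algebra over `P`
(`OperadData.actFun_comp`), and `x × y` is the result of substituting `y` in all the inputs of `x`. The
map `x ↦ x × y` is therefore a morphism of algebras (`OperadData.prod_actFun`), which gives the
associativity of the product. The equation `y × x = 1` is triangular in the homogeneous components of
`y`, so that every element whose linear part is a nonzero multiple of the unit is invertible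
(`OperadData.mem_G_of_linear_part`).

These facts are applied to the pre-Lie operad. Its axioms come down to a description of the trees
occurring in a composition (`LabelledTree.IsGraft`): such a tree determines the attaching vertices, so it
occurs with multiplicity one, and the associativity is a bijection between two ways of inserting trees
into trees (`LabelledTree.exists_isGraft_assoc`).

A composition of trees contains a linear tree only if all the trees involved are linear, and then
exactly one (`LabelledTree.existsUnique_isGraft_isLinear`): the edge entering a vertex has to be
attached to the end of the linear tree replacing it. Hence the nonlinear trees span an ideal, and the
sum of the coefficients of the linear trees is multiplicative (`PreLie.linearSum_comp`). As all linear
trees with `n` vertices are isomorphic, this sum identifies `As(n)_{S_n}` with `ℚ` for `n ≥ 1`, and turns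
the product into the composition of power series (`PreLie.linearSeries_prod`). The laws for the
associative operad follow from those of the pre-Lie operad by surjectivity of `φ`.

The power series of `v^{← k}` is `x ^ k`, so that the one of `exp*` is `exp x - 1`; its inverse for the
composition is `log (1 + x)`. The coefficient of a linear tree in `exp*` can be read off this series.
-/

noncomputable section

/-! ### Trees obtained by replacing vertices by trees -/

namespace LabelledTree

variable {I I' : Type}

@[simp] theorem relabel_root (e : I ≃ I') (T : LabelledTree I) : (T.relabel e).root = e T.root := rfl

@[simp] theorem relabel_parent (e : I ≃ I') (T : LabelledTree I) (i : I) :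
    (T.relabel e).parent (e i) = e (T.parent i) := by
  simp [relabel]

theorem relabel_refl (T : LabelledTree I) : T.relabel (Equiv.refl I) = T := rfl

/-- The tree `U` arises from `T` by replacing every vertex `i` by the tree `S i`, for some choice of
the vertices to which the incoming edges of `i` are attached. -/
structure IsGraft {J : I → Type} (U : LabelledTree (Σ i, J i)) (T : LabelledTree I)
    (S : ∀ i, LabelledTree (J i)) : Prop where
  root_eq : U.root = ⟨T.root, (S T.root).root⟩
  parent_eq : ∀ i j, j ≠ (S i).root → U.parent ⟨i, j⟩ = ⟨i, (S i).parent j⟩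
  parent_fst : ∀ i, i ≠ T.root → (U.parent ⟨i, (S i).root⟩).1 = T.parent i

theorem isGraft_graft {J : I → Type} (T : LabelledTree I) (S : ∀ i, LabelledTree (J i))
    (f : T.AttachMap J) : IsGraft (T.graft S f) T S where
  root_eq := rfl
  parent_eq i j h := by simp [graft, graftParent, h]
  parent_fst i h := by simp [graft, graftParent, h]

theorem graft_parent_root {J : I → Type} (T : LabelledTree I) (S : ∀ i, LabelledTree (J i))
    (f : T.AttachMap J) (i : I) (h : i ≠ T.root) :
    (T.graft S f).parent ⟨i, (S i).root⟩ = ⟨T.parent i, f ⟨i, h⟩⟩ := by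
  simp [graft, graftParent, h]

theorem graft_injective {J : I → Type} (T : LabelledTree I) (S : ∀ i, LabelledTree (J i)) :
    Function.Injective (T.graft S) := by
  intro f g h
  funext ⟨i, hi⟩
  have h' := congrArg (fun U => U.parent ⟨i, (S i).root⟩) h
  simp only [graft_parent_root T S _ i hi] at h'
  simpa using h'

theorem IsGraft.exists_graft {J : I → Type} {U : LabelledTree (Σ i, J i)} {T : LabelledTree I}
    {S : ∀ i, LabelledTree (J i)} (h : IsGraft U T S) : ∃ f, T.graft S f = U := by
  -- The attaching vertex of the edge leaving `i` is the second component of the parent of the root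
  -- of `S i`.
  have key : ∀ i : {i : I // i ≠ T.root}, ∃ k : J (T.parent i),
      U.parent ⟨i, (S i).root⟩ = ⟨T.parent i, k⟩ := by
    rintro ⟨i, hi⟩
    have := h.parent_fst i hi
    generalize U.parent ⟨i, (S i).root⟩ = a at this
    obtain ⟨a, b⟩ := a
    obtain rfl : a = T.parent i := this
    exact ⟨b, rfl⟩
  choose f hf using key
  refine ⟨f, LabelledTree.ext h.root_eq.symm (funext ?_)⟩
  rintro ⟨i, j⟩
  by_cases hj : j = (S i).root
  · subst hj
    by_cases hi : i = T.root
    · subst hi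
      rw [← h.root_eq, U.parent_root, h.root_eq]
      exact (T.graft S f).parent_root
    · rw [graft_parent_root T S f i hi, hf ⟨i, hi⟩]
  · rw [h.parent_eq i j hj, (isGraft_graft T S f).parent_eq i j hj]

/-- In a tree replacing the vertices of `U` by trees `R`, the tree `U` is determined by the result. -/
theorem IsGraft.outer_unique {J : I → Type} {V : LabelledTree (Σ i, J i)} {U U' : LabelledTree I}
    {R : ∀ i, LabelledTree (J i)} (h : IsGraft V U R) (h' : IsGraft V U' R) : U = U' := by
  have hr : U.root = U'.root := by
    have := congrArg Sigma.fst (h.root_eq.symm.trans h'.root_eq)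
    exact this
  refine LabelledTree.ext hr (funext fun i => ?_)
  by_cases hi : i = U.root
  · subst hi
    rw [U.parent_root, hr, U'.parent_root]
  · rw [← h.parent_fst i hi, h'.parent_fst i (hr ▸ hi)]

/-- In a tree replacing the vertices of `T` by trees `W`, the trees `W i` are determined by the result
and by their roots. -/
theorem IsGraft.inner_unique {J : I → Type} {V : LabelledTree (Σ i, J i)} {T : LabelledTree I}
    {W W' : ∀ i, LabelledTree (J i)} (h : IsGraft V T W) (h' : IsGraft V T W')
    (hr : ∀ i, (W i).root = (W' i).root) : W = W' := by
  funext i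
  refine LabelledTree.ext (hr i) (funext fun j => ?_)
  by_cases hj : j = (W i).root
  · subst hj
    rw [(W i).parent_root, hr, (W' i).parent_root]
  · have := (h.parent_eq i j hj).symm.trans (h'.parent_eq i j (hr i ▸ hj))
    simpa using this

/-- Associativity of the substitution of trees: replacing the vertices of `T` by the trees `S i`, and
then those of the result by the trees `R i j`, amounts to replacing the vertices of `T` by trees
obtained by replacing the vertices of `S i` by the `R i j`. -/
theorem exists_isGraft_assoc {J : I → Type} {K : ∀ i, J i → Type}
    (V : LabelledTree (Σ a : (Σ i, J i), K a.1 a.2)) (T : LabelledTree I)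
    (S : ∀ i, LabelledTree (J i)) (R : ∀ i j, LabelledTree (K i j)) :
    (∃ U, IsGraft V U (fun a => R a.1 a.2) ∧ IsGraft U T S) ↔
      ∃ W : ∀ i, LabelledTree (Σ j, K i j),
        IsGraft (V.relabel (Equiv.sigmaAssoc K)) T W ∧ ∀ i, IsGraft (W i) (S i) (R i) := by
  constructor
  · rintro ⟨U, hV, hU⟩
    have key : ∀ i (j : {j : J i // j ≠ (S i).root}), ∃ k : K i ((S i).parent j),
        V.parent ⟨⟨i, j⟩, (R i j).root⟩ = ⟨⟨i, (S i).parent j⟩, k⟩ := by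
      rintro i ⟨j, hj⟩
      have h1 := hV.parent_fst ⟨i, j⟩ (by
        rw [hU.root_eq]; intro h
        rw [Sigma.mk.injEq] at h
        obtain ⟨rfl, h⟩ := h
        exact hj (eq_of_heq h))
      rw [hU.parent_eq i j hj] at h1
      generalize V.parent ⟨⟨i, j⟩, (R i j).root⟩ = a at h1
      obtain ⟨a, b⟩ := a
      obtain rfl : a = _ := h1
      exact ⟨b, rfl⟩
    choose f hf using key
    refine ⟨fun i => (S i).graft (R i) (f i), ⟨?_, ?_, ?_⟩, fun i => isGraft_graft _ _ _⟩
    · have h (a : Σ i, J i) (ha : a = ⟨T.root, (S T.root).root⟩) :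
          Equiv.sigmaAssoc K ⟨a, (R a.1 a.2).root⟩ =
            ⟨T.root, ((S T.root).graft (R T.root) (f T.root)).root⟩ := by
        subst ha
        rfl
      rw [relabel_root, hV.root_eq]
      exact h _ hU.root_eq
    · rintro i ⟨j, k⟩ hjk
      change Equiv.sigmaAssoc K (V.parent ⟨⟨i, j⟩, k⟩) = _
      by_cases hk : k = (R i j).root
      · subst hk
        have hj : j ≠ (S i).root := by
          rintro rfl
          exact hjk rfl
        rw [hf i ⟨j, hj⟩, graft_parent_root _ _ _ _ hj]
        rfl
      · rw [hV.parent_eq ⟨i, j⟩ k hk, (isGraft_graft (S i) (R i) (f i)).parent_eq j k hk]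
        rfl
    · intro i hi
      change (V.parent ⟨⟨i, (S i).root⟩, (R i (S i).root).root⟩).1.1 = _
      rw [hV.parent_fst ⟨i, (S i).root⟩ (by
        rw [hU.root_eq]; exact fun h => hi (congrArg Sigma.fst h)), hU.parent_fst i hi]
  · rintro ⟨W, hV, hW⟩
    have key : ∀ i : {i : I // i ≠ T.root}, ∃ j : J (T.parent i),
        (V.parent ⟨⟨i, (S i).root⟩, (R i (S i).root).root⟩).1 = ⟨T.parent i, j⟩ := by
      rintro ⟨i, hi⟩
      have h1 := hV.parent_fst i hi
      rw [(hW i).root_eq] at h1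
      change (V.parent ⟨⟨i, (S i).root⟩, (R i (S i).root).root⟩).1.1 = _ at h1
      generalize V.parent ⟨⟨i, (S i).root⟩, (R i (S i).root).root⟩ = a at h1
      obtain ⟨⟨a, b⟩, c⟩ := a
      obtain rfl : a = _ := h1
      exact ⟨b, rfl⟩
    choose f hf using key
    refine ⟨T.graft S f, ⟨?_, ?_, ?_⟩, isGraft_graft _ _ _⟩
    · apply (Equiv.sigmaAssoc K).injective
      refine hV.root_eq.trans ?_
      rw [(hW _).root_eq]
      rfl
    · rintro ⟨i, j⟩ k hk
      apply (Equiv.sigmaAssoc K).injective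
      refine (hV.parent_eq i ⟨j, k⟩ ?_).trans ?_
      · rw [(hW i).root_eq]
        intro h
        rw [Sigma.mk.injEq] at h
        obtain ⟨rfl, h⟩ := h
        exact hk (eq_of_heq h)
      · rw [(hW i).parent_eq j k hk]
        rfl
    · rintro ⟨i, j⟩ hij
      by_cases hj : j = (S i).root
      · subst hj
        have hi : i ≠ T.root := by
          rintro rfl
          exact hij rfl
        rw [graft_parent_root T S f i hi]
        exact hf ⟨i, hi⟩
      · have h1 := hV.parent_eq i ⟨j, (R i j).root⟩ (by
          rw [(hW i).root_eq]
          exact fun h => hj (congrArg Sigma.fst h))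
        change Equiv.sigmaAssoc K (V.parent ⟨⟨i, j⟩, (R i j).root⟩) = _ at h1
        rw [← Equiv.eq_symm_apply] at h1
        rw [h1, (isGraft_graft T S f).parent_eq i j hj]
        change (⟨i, ((W i).parent ⟨j, (R i j).root⟩).1⟩ : Σ i, J i) = _
        rw [(hW i).parent_fst j hj]

theorem isGraft_relabel_outer {J : I' → Type} (e : I ≃ I') (U : LabelledTree (Σ i, J (e i)))
    (T : LabelledTree I) (S : ∀ i, LabelledTree (J i)) :
    IsGraft (U.relabel (Equiv.sigmaCongrLeft e)) (T.relabel e) S ↔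
      IsGraft U T (fun i => S (e i)) := by
  have hp (i : I) (j : J (e i)) : (U.relabel (Equiv.sigmaCongrLeft e)).parent ⟨e i, j⟩ =
      Equiv.sigmaCongrLeft e (U.parent ⟨i, j⟩) :=
    relabel_parent (Equiv.sigmaCongrLeft e) U ⟨i, j⟩
  constructor
  · intro h
    refine ⟨(Equiv.sigmaCongrLeft (β := J) e).injective h.root_eq, fun i j hj => ?_, fun i hi => ?_⟩
    · apply (Equiv.sigmaCongrLeft (β := J) e).injective
      rw [← hp]
      exact h.parent_eq (e i) j hj
    · have := h.parent_fst (e i) (fun h => hi (e.injective h))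
      rw [hp, relabel_parent] at this
      exact e.injective this
  · intro h
    refine ⟨congrArg (Equiv.sigmaCongrLeft (β := J) e) h.root_eq, fun i j hj => ?_, fun i hi => ?_⟩
    · obtain ⟨i, rfl⟩ := e.surjective i
      rw [hp, h.parent_eq i j hj]
      rfl
    · obtain ⟨i, rfl⟩ := e.surjective i
      rw [hp, relabel_parent, ← h.parent_fst i (fun h => hi (congrArg e h))]
      rfl

theorem isGraft_relabel_inner {J J' : I → Type} (e : ∀ i, J i ≃ J' i) (U : LabelledTree (Σ i, J i))
    (T : LabelledTree I) (S : ∀ i, LabelledTree (J i)) :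
    IsGraft (U.relabel (Equiv.sigmaCongrRight e)) T (fun i => (S i).relabel (e i)) ↔
      IsGraft U T S := by
  have hp (i : I) (j : J i) : (U.relabel (Equiv.sigmaCongrRight e)).parent ⟨i, e i j⟩ =
      Equiv.sigmaCongrRight e (U.parent ⟨i, j⟩) :=
    relabel_parent (Equiv.sigmaCongrRight e) U ⟨i, j⟩
  constructor
  · intro h
    refine ⟨(Equiv.sigmaCongrRight e).injective h.root_eq, fun i j hj => ?_, fun i hi => ?_⟩
    · apply (Equiv.sigmaCongrRight e).injective
      rw [← hp, h.parent_eq i (e i j) (fun h => hj ((e i).injective h)), relabel_parent]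
      rfl
    · have := h.parent_fst i hi
      rw [relabel_root, hp] at this
      exact this
  · intro h
    refine ⟨congrArg (Equiv.sigmaCongrRight e) h.root_eq, fun i j hj => ?_, fun i hi => ?_⟩
    · obtain ⟨j, rfl⟩ := (e i).surjective j
      rw [hp, h.parent_eq i j (fun h => hj (congrArg (e i) h)), relabel_parent]
      rfl
    · rw [relabel_root, hp, ← h.parent_fst i hi]
      rfl

end LabelledTree

namespace PreLie

open LabelledTree

/-- The coefficient of a labelled tree in an operation. -/
def coeff {I : Type} (T : LabelledTree I) : PreLie.obj I →ₗ[ℚ] ℚ := Finsupp.lapply T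

/-- A labelled tree, seen as an operation of the pre-Lie operad. -/
def ofTree {I : Type} (T : LabelledTree I) : PreLie.obj I := Finsupp.single T (1 : ℚ)

open Classical in
theorem coeff_ofTree {I : Type} (U T : LabelledTree I) :
    coeff U (ofTree T) = if T = U then 1 else 0 := Finsupp.single_apply

@[ext] theorem obj_ext {I : Type} {x y : PreLie.obj I} (h : ∀ T, coeff T x = coeff T y) : x = y :=
  Finsupp.ext h

theorem coeff_map {I I' : Type} (e : I ≃ I') (T : LabelledTree I) (x : PreLie.obj I) :
    coeff (T.relabel e) (PreLie.map e x) = coeff T x :=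
  Finsupp.mapDomain_apply (LabelledTree.relabelEquiv e).injective x T

open Classical in
theorem comp_eq_sum {I : Type} [Fintype I] {J : I → Type} [∀ i, Fintype (J i)]
    (x : PreLie.obj I) (y : ∀ i, PreLie.obj (J i)) :
    PreLie.comp x y = ∑ T : LabelledTree I, ∑ S : ∀ i, LabelledTree (J i),
      (coeff T x * ∏ i, coeff (S i) (y i)) • ∑ f : T.AttachMap J, ofTree (T.graft S f) := rfl

open Classical in
/-- A tree `U` appears in the composition of the trees `T` and `S i` exactly when it is obtained by
replacing the vertices of `T` by the `S i`, and then with multiplicity one. -/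
theorem coeff_comp {I : Type} [Fintype I] {J : I → Type} [∀ i, Fintype (J i)]
    (x : PreLie.obj I) (y : ∀ i, PreLie.obj (J i)) (U : LabelledTree (Σ i, J i)) :
    coeff U (PreLie.comp x y) = ∑ T : LabelledTree I, ∑ S : ∀ i, LabelledTree (J i),
      if IsGraft U T S then coeff T x * ∏ i, coeff (S i) (y i) else 0 := by
  rw [comp_eq_sum, map_sum]
  refine Finset.sum_congr rfl fun T _ => ?_
  rw [map_sum]
  refine Finset.sum_congr rfl fun S _ => ?_
  rw [map_smul, map_sum]
  simp_rw [coeff_ofTree]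
  split_ifs with h
  · obtain ⟨f, rfl⟩ := h.exists_graft
    rw [Finset.sum_eq_single f]
    · simp
    · intro g _ hg
      rw [if_neg fun h => hg (graft_injective T S h)]
    · simp
  · rw [Finset.sum_eq_zero, smul_zero]
    intro f _
    rw [if_neg]
    rintro rfl
    exact h (isGraft_graft T S f)

end PreLie

/-! ### The completion as an algebra over the operad -/

namespace OperadData

/-- The axioms of a symmetric operad without operations of arity zero. -/
structure IsOperad (P : OperadData) : Prop where
  map_refl : ∀ {I : Type} (p : P.obj I), P.map (Equiv.refl I) p = p
  map_trans : ∀ {I I' I'' : Type} (e : I ≃ I') (e' : I' ≃ I'') (p : P.obj I),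
    P.map e' (P.map e p) = P.map (e.trans e') p
  subsingleton : ∀ (I : Type) [IsEmpty I], Subsingleton (P.obj I)
  exists_multilinear : ∀ {I : Type} [Fintype I] (J : I → Type) [∀ i, Fintype (J i)],
    ∃ F : P.obj I →ₗ[ℚ] MultilinearMap ℚ (fun i => P.obj (J i)) (P.obj (Σ i, J i)),
      ∀ p q, F p q = P.comp p q
  comp_map_left : ∀ {I I' : Type} [Fintype I] [Fintype I'] {J : I' → Type} [∀ i, Fintype (J i)]
    (e : I ≃ I') (p : P.obj I) (q : ∀ i, P.obj (J i)),
    P.comp (P.map e p) q = P.map (Equiv.sigmaCongrLeft e) (P.comp p fun i => q (e i))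
  comp_map_right : ∀ {I : Type} [Fintype I] {J J' : I → Type} [∀ i, Fintype (J i)]
    [∀ i, Fintype (J' i)] (p : P.obj I) (e : ∀ i, J i ≃ J' i) (q : ∀ i, P.obj (J i)),
    P.comp p (fun i => P.map (e i) (q i)) = P.map (Equiv.sigmaCongrRight e) (P.comp p q)
  comp_assoc : ∀ {I : Type} [Fintype I] {J : I → Type} [∀ i, Fintype (J i)]
    {K : ∀ i, J i → Type} [∀ i j, Fintype (K i j)] (p : P.obj I) (q : ∀ i, P.obj (J i))
    (r : ∀ i j, P.obj (K i j)),
    P.map (Equiv.sigmaAssoc K) (P.comp (P.comp p q) fun a : Σ i, J i => r a.1 a.2) =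
      P.comp p fun i => P.comp (q i) (r i)
  unit_comp : ∀ {J : Unit → Type} [∀ i, Fintype (J i)] (q : ∀ i, P.obj (J i)),
    P.map (Equiv.uniqueSigma J) (P.comp P.unit q) = q ()
  comp_unit : ∀ {I : Type} [Fintype I] (p : P.obj I),
    P.map (Equiv.sigmaUnique I fun _ => Unit) (P.comp p fun _ => P.unit) = p

variable {P : OperadData}

theorem mk_rep {n : ℕ} (x : P.Coinv n) : (P.coinvKer n).mkQ (rep x) = x :=
  Function.surjInv_eq _ x

/-- Two operations with inputs labelled by finite sets, related by a bijection of these sets, have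
the same class. -/
theorem cls_map (hP : P.IsOperad) {I I' : Type} [Fintype I] [Fintype I'] (e : I ≃ I') (N : ℕ)
    (p : P.obj I) : cls N (P.map e p) = cls N p := by
  have hc := Fintype.card_congr e
  unfold cls
  by_cases h : Fintype.card I = N
  · rw [dif_pos h, dif_pos (hc.symm.trans h), hP.map_trans, ← sub_eq_zero, ← Submodule.Quotient.mk_sub,
      Submodule.Quotient.mk_eq_zero]
    refine Submodule.subset_span ⟨(Fintype.equivFinOfCardEq h).symm.trans
      (e.trans (Fintype.equivFinOfCardEq (hc.symm.trans h))), P.map (Fintype.equivFinOfCardEq h) p, ?_⟩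
    rw [hP.map_trans]
    congr 3
    ext i
    simp
  · rw [dif_neg h, dif_neg (fun h' => h (hc.trans h'))]

theorem cls_of_card_ne {I : Type} [Fintype I] {N : ℕ} (h : Fintype.card I ≠ N) (p : P.obj I) :
    cls N p = 0 := dif_neg h

/-- The class of an operation, as a linear map. -/
def clsLinear (P : OperadData) (I : Type) [Fintype I] (N : ℕ) : P.obj I →ₗ[ℚ] P.Coinv N :=
  open Classical in
  if h : Fintype.card I = N then
    (P.coinvKer N).mkQ ∘ₗ P.map (Fintype.equivFinOfCardEq h)
  else 0

theorem clsLinear_apply {I : Type} [Fintype I] (N : ℕ) (p : P.obj I) :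
    clsLinear P I N p = cls N p := by
  unfold clsLinear cls
  split_ifs <;> rfl

theorem cls_eq_mkQ {n : ℕ} (p : P.obj (Fin n)) :
    cls n p = (P.coinvKer n).mkQ p := by
  have h : Fintype.card (Fin n) = n := Fintype.card_fin n
  rw [cls, dif_pos h, ← sub_eq_zero]
  refine (Submodule.Quotient.mk_sub _ ).symm.trans ?_
  rw [Submodule.Quotient.mk_eq_zero]
  exact Submodule.subset_span ⟨_, p, rfl⟩

theorem cls_rep {n : ℕ} (x : P.Coinv n) : cls n (rep x) = x := by
  rw [cls_eq_mkQ, mk_rep]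

/-- A multilinear map only depends on the classes of its arguments modulo subspaces, if it vanishes
as soon as one of its arguments lies in the corresponding subspace. -/
theorem _root_.MultilinearMap.congr_of_sub_mem {ι R V : Type*} {M : ι → Type*}
    [Fintype ι] [DecidableEq ι] [CommRing R] [∀ i, AddCommGroup (M i)] [∀ i, Module R (M i)] [AddCommGroup V] [Module R V]
    (F : MultilinearMap R M V) (K : ∀ i, Submodule R (M i))
    (hF : ∀ q i, ∀ k ∈ K i, F (Function.update q i k) = 0) (q q' : ∀ i, M i)
    (h : ∀ i, q' i - q i ∈ K i) : F q = F q' := by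
  have key : ∀ s : Finset ι, F (s.piecewise q' q) = F q := by
    intro s
    induction s using Finset.induction with
    | empty => simp
    | insert j s hj ih =>
      rw [Finset.piecewise_insert, ← ih, ← sub_eq_zero]
      nth_rewrite 2 [← Function.update_eq_self j (s.piecewise q' q)]
      rw [← F.map_update_sub]
      apply hF
      rw [Finset.piecewise_eq_of_notMem _ _ _ hj]
      exact h j
  simpa using (key Finset.univ).symm

section

variable {I : Type} [Fintype I]

/-- The class of a composition only depends on the classes of the operations that are plugged in. -/
theorem cls_comp_congr (hP : P.IsOperad) (N : ℕ) {n : I → ℕ} (p : P.obj I)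
    (q q' : ∀ i, P.obj (Fin (n i)))
    (h : ∀ i, (P.coinvKer (n i)).mkQ (q i) = (P.coinvKer (n i)).mkQ (q' i)) :
    cls N (P.comp p q) = cls N (P.comp p q') := by
  classical
  obtain ⟨F, hF⟩ := hP.exists_multilinear (fun i => Fin (n i))
  have := ((clsLinear P _ N).compMultilinearMap (F p)).congr_of_sub_mem
    (fun i => P.coinvKer (n i)) ?_ q q' (fun i => ?_)
  · simpa [hF, clsLinear_apply] using this
  · intro q i k hk
    rw [coinvKer] at hk
    induction hk using Submodule.span_induction with
    | mem k hk =>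
      obtain ⟨σ, x, rfl⟩ := hk
      rw [MultilinearMap.map_update_sub, sub_eq_zero, LinearMap.compMultilinearMap_apply,
        LinearMap.compMultilinearMap_apply, hF, hF, clsLinear_apply, clsLinear_apply,
        ← cls_map hP (Equiv.sigmaCongrRight
          (Function.update (fun i => Equiv.refl (Fin (n i))) i σ)) N (P.comp p (Function.update q i x)),
        ← hP.comp_map_right]
      congr 2
      funext j
      by_cases hj : j = i
      · subst hj
        simp
      · simp [hj, hP.map_refl]
    | zero => exact MultilinearMap.map_update_zero _ _ _
    | add k l _ _ hk hl => rw [MultilinearMap.map_update_add, hk, hl, add_zero]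
    | smul c k _ hk => rw [MultilinearMap.map_update_smul, hk, smul_zero]
  · have := h i
    rwa [eq_comm, ← sub_eq_zero, ← map_sub, Submodule.mkQ_apply, Submodule.Quotient.mk_eq_zero] at this

theorem exists_linear_rep (P : OperadData) (n : ℕ) :
    ∃ s : P.Coinv n →ₗ[ℚ] P.obj (Fin n), (P.coinvKer n).mkQ ∘ₗ s = LinearMap.id :=
  LinearMap.exists_rightInverse_of_surjective _ (Submodule.range_mkQ _)

/-- The class in degree `N` of `γ(p; c_1, …, c_m)` for coinvariants `c_i`, as a linear function of
`p` and a multilinear function of the `c_i`. -/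
theorem exists_multilinear_coinv (hP : P.IsOperad) (N : ℕ) (n : I → ℕ) :
    ∃ F : P.obj I →ₗ[ℚ] MultilinearMap ℚ (fun i => P.Coinv (n i)) (P.Coinv N),
      ∀ p c, F p c = cls N (P.comp p fun i => rep (c i)) := by
  obtain ⟨F, hF⟩ := hP.exists_multilinear (I := I) (fun i => Fin (n i))
  choose s hs using fun i => exists_linear_rep P (n i)
  refine ⟨MultilinearMap.compLinearMapₗ s ∘ₗ LinearMap.compMultilinearMapₗ ℚ (clsLinear P _ N) ∘ₗ F,
    fun p c => ?_⟩
  change clsLinear P _ N (F p fun i => s i (c i)) = _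
  rw [hF, clsLinear_apply]
  refine cls_comp_congr hP N p _ _ fun i => ?_
  rw [mk_rep]
  exact LinearMap.congr_fun (hs i) (c i)

end

section Act

variable {I : Type} [Fintype I]

open Classical in
/-- The structure of algebra over the operad on the completed free algebra on one generator, for
operations with inputs labelled by any finite set. -/
def actFun (p : P.obj I) (z : I → P.Completion) : P.Completion := fun N =>
  ∑ n ∈ Fintype.piFinset (fun _ : I => Finset.Icc 1 N), cls N (P.comp p fun i => rep (z i (n i)))

theorem act_eq_actFun {m : ℕ} (p : P.obj (Fin m)) (z : Fin m → P.Completion) :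
    act p z = actFun p z := by
  funext N
  unfold act actFun
  congr!

theorem cls_comp_eq_zero_of_lt {J : I → Type} [∀ i, Fintype (J i)] {N : ℕ} (p : P.obj I)
    (q : ∀ i, P.obj (J i)) (i : I) (h : N < Fintype.card (J i)) : cls N (P.comp p q) = 0 := by
  apply cls_of_card_ne
  rw [Fintype.card_sigma]
  have := Finset.single_le_sum (f := fun i => Fintype.card (J i)) (fun _ _ => Nat.zero_le _)
    (Finset.mem_univ i)
  omega

theorem comp_eq_zero (hP : P.IsOperad) {J : I → Type} [∀ i, Fintype (J i)] (p : P.obj I)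
    (q : ∀ i, P.obj (J i)) (i : I) (h : q i = 0) : P.comp p q = 0 := by
  obtain ⟨F, hF⟩ := hP.exists_multilinear (I := I) J
  rw [← hF]
  exact (F p).map_coord_zero i h

theorem eq_zero_of_isEmpty (hP : P.IsOperad) {J : Type} [IsEmpty J] (q : P.obj J) : q = 0 :=
  (hP.subsingleton J).elim _ _

open Classical in
/-- The sum defining the action may be taken over any range of indices containing `0, …, N`. -/
theorem actFun_apply (hP : P.IsOperad) (p : P.obj I) (z : I → P.Completion) {N M : ℕ} (hM : N < M) :
    actFun p z N = ∑ n ∈ Fintype.piFinset (fun _ : I => Finset.range M),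
      cls N (P.comp p fun i => rep (z i (n i))) := by
  refine Finset.sum_subset (fun n hn => ?_) (fun n _ hn => ?_)
  · simp only [Fintype.mem_piFinset, Finset.mem_Icc, Finset.mem_range] at hn ⊢
    exact fun i => (hn i).2.trans_lt hM
  · simp only [Fintype.mem_piFinset, Finset.mem_Icc, not_forall] at hn
    obtain ⟨i, hi⟩ := hn
    by_cases h0 : n i = 0
    · rw [comp_eq_zero hP _ _ i, ← clsLinear_apply, map_zero]
      have : IsEmpty (Fin (n i)) := by rw [h0]; infer_instance
      exact eq_zero_of_isEmpty hP _
    · exact cls_comp_eq_zero_of_lt _ _ i (by rw [Fintype.card_fin]; omega)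

theorem actFun_congr (p : P.obj I) {z w : I → P.Completion} {N : ℕ}
    (h : ∀ i, ∀ n ≤ N, z i n = w i n) : actFun p z N = actFun p w N := by
  refine Finset.sum_congr rfl fun n hn => ?_
  simp only [Fintype.mem_piFinset, Finset.mem_Icc] at hn
  congr 2
  funext i
  rw [h i _ (hn i).2]

open Classical in
theorem actFun_sum (hP : P.IsOperad) (p : P.obj I) {α : I → Type} (A : ∀ i, Finset (α i))
    (w : ∀ i, α i → P.Completion) (N : ℕ) :
    actFun p (fun i => ∑ l ∈ A i, w i l) N =
      ∑ l ∈ Fintype.piFinset A, actFun p (fun i => w i (l i)) N := by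
  unfold actFun
  rw [Finset.sum_comm]
  refine Finset.sum_congr rfl fun n _ => ?_
  obtain ⟨F, hF⟩ := exists_multilinear_coinv hP N n
  simp_rw [← hF, Finset.sum_apply]
  exact (F p).map_sum_finset _ _

theorem exists_linear_actFun (hP : P.IsOperad) (z : I → P.Completion) :
    ∃ F : P.obj I →ₗ[ℚ] P.Completion, ∀ p, F p = actFun p z := by
  choose F hF using fun (N : ℕ) (n : I → ℕ) => exists_multilinear_coinv (P := P) hP N n
  refine ⟨{ toFun := fun p => actFun p z, map_add' := fun p q => ?_, map_smul' := fun c p => ?_ },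
    fun p => rfl⟩
  · funext N
    simp only [actFun, ← hF, map_add, add_apply, Finset.sum_add_distrib, Pi.add_apply]
  · funext N
    simp only [actFun, ← hF, map_smul, smul_apply, Finset.smul_sum, Pi.smul_apply,
      RingHom.id_apply]

variable (P) in
/-- The classes of an operation in all degrees; only the one in degree the arity can be nonzero. -/
def clsAll (p : P.obj I) : P.Completion := fun N => cls N p

/-- The action of `p` on the homogeneous elements given by the `r i` is given by `γ(p; r)`. -/
theorem actFun_clsAll (hP : P.IsOperad) {J : I → Type} [∀ i, Fintype (J i)] (p : P.obj I)
    (r : ∀ i, P.obj (J i)) : actFun p (fun i => clsAll P (r i)) = clsAll P (P.comp p r) := by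
  classical
  funext N
  rw [actFun_apply hP p _ (Nat.lt_succ_self N)]
  by_cases h : ∀ i, Fintype.card (J i) < N + 1
  · rw [Finset.sum_eq_single (fun i => Fintype.card (J i))]
    · have := hP.comp_map_right p (fun i => Fintype.equivFin (J i)) r
      change cls N _ = cls N _
      rw [← cls_map hP (Equiv.sigmaCongrRight fun i => Fintype.equivFin (J i)) N (P.comp p r), ← this]
      refine cls_comp_congr hP N p _ _ fun i => ?_
      rw [mk_rep, ← cls_eq_mkQ]
      exact (cls_map hP _ _ _).symm
    · intro n _ hn
      obtain ⟨i, hi⟩ := Function.ne_iff.mp hn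
      have h0 : clsAll P (r i) (n i) = 0 := cls_of_card_ne (fun h => hi h.symm) _
      obtain ⟨F, hF⟩ := exists_multilinear_coinv (P := P) hP N n
      rw [← hF p fun i => clsAll P (r i) (n i)]
      exact (F p).map_coord_zero i h0
    · intro hn
      exact absurd (Fintype.mem_piFinset.mpr fun i => Finset.mem_range.mpr (h i)) hn
  · push Not at h
    obtain ⟨i, hi⟩ := h
    refine (Finset.sum_eq_zero fun n hn => ?_).trans (cls_comp_eq_zero_of_lt p r i hi).symm
    have hn' := Finset.mem_range.mp (Fintype.mem_piFinset.mp hn i)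
    have h0 : clsAll P (r i) (n i) = 0 := cls_of_card_ne (by omega) _
    obtain ⟨F, hF⟩ := exists_multilinear_coinv (P := P) hP N n
    rw [← hF p fun i => clsAll P (r i) (n i)]
    exact (F p).map_coord_zero i h0

open Classical in
theorem actFun_eq_sum_clsAll (hP : P.IsOperad) (p : P.obj I) (z : I → P.Completion) {N M : ℕ}
    (hM : N < M) : actFun p z N = (∑ n ∈ Fintype.piFinset (fun _ : I => Finset.range M),
      clsAll P (P.comp p fun i => rep (z i (n i)))) N := by
  rw [actFun_apply hP p z hM, Finset.sum_apply]
  rfl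

/-- The completion is an algebra over the operad. -/
theorem actFun_comp (hP : P.IsOperad) {J : I → Type} [∀ i, Fintype (J i)] (p : P.obj I)
    (q : ∀ i, P.obj (J i)) (z : ∀ i, J i → P.Completion) :
    actFun (P.comp p q) (fun a : Σ i, J i => z a.1 a.2) = actFun p fun i => actFun (q i) (z i) := by
  classical
  funext N
  -- Up to degree `N`, each `actFun (q i) (z i)` is a finite sum of classes of operations.
  rw [actFun_congr p (N := N) (w := fun i =>
      ∑ n ∈ Fintype.piFinset (fun _ : J i => Finset.range (N + 1)),
      clsAll P (P.comp (q i) fun j => rep (z i j (n j))))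
    (fun i n hn => actFun_eq_sum_clsAll hP (q i) (z i) (Nat.lt_succ_of_le hn)),
    actFun_sum hP, actFun_apply hP _ _ (Nat.lt_succ_self N)]
  refine Finset.sum_equiv (Equiv.piCurry fun _ _ => ℕ) (fun n => ?_) (fun n _ => ?_)
  · simp [Fintype.mem_piFinset, Sigma.forall, Sigma.curry]
  · rw [actFun_clsAll hP, clsAll,
      ← cls_map hP (Equiv.sigmaAssoc fun i j => Fin (n ⟨i, j⟩)) N]
    congr 1
    exact hP.comp_assoc p q fun i j => rep (z i j (n ⟨i, j⟩))

theorem actFun_map (hP : P.IsOperad) {I' : Type} [Fintype I'] (e : I ≃ I') (p : P.obj I)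
    (z : I' → P.Completion) : actFun (P.map e p) z = actFun p fun i => z (e i) := by
  classical
  funext N
  refine Finset.sum_equiv (e.symm.arrowCongr (Equiv.refl ℕ)) (fun n => ?_) (fun n _ => ?_)
  · simp only [Fintype.mem_piFinset, Equiv.arrowCongr_apply]
    exact ⟨fun h i => h _, fun h i => by simpa using h (e.symm i)⟩
  · rw [hP.comp_map_left, cls_map hP]
    rfl

theorem actFun_unit (hP : P.IsOperad) (z : Unit → P.Completion) : actFun P.unit z = z () := by
  classical
  funext N
  rw [actFun_apply hP _ _ (Nat.lt_succ_self N), Finset.sum_eq_single fun _ => N]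
  · rw [← cls_map hP (Equiv.uniqueSigma _), hP.unit_comp (J := fun _ => Fin N), cls_rep]
  · intro n _ hn
    apply cls_of_card_ne
    rw [Fintype.card_congr (Equiv.uniqueSigma _), Fintype.card_fin]
    intro h
    exact hn (funext fun _ => h)
  · intro h
    exact absurd ((@Fintype.mem_piFinset _ (Classical.decEq _) _ _ _ _).mpr fun _ => by simp) h

end Act

end OperadData

/-! ### The product and the invertible elements -/

namespace OperadData

variable {P : OperadData}

theorem actFun_eq_zero_of_lt {I : Type} [Fintype I] (p : P.obj I) (z : I → P.Completion) {N : ℕ}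
    (h : N < Fintype.card I) : actFun p z N = 0 := by
  refine Finset.sum_eq_zero fun n hn => cls_of_card_ne ?_ _
  simp only [Fintype.mem_piFinset, Finset.mem_Icc] at hn
  rw [Fintype.card_sigma]
  have := Finset.sum_le_sum (s := Finset.univ) (f := fun _ : I => 1)
    (g := fun i => Fintype.card (Fin (n i))) fun i _ => by rw [Fintype.card_fin]; exact (hn i).1
  simp only [Finset.sum_const, Finset.card_univ, smul_eq_mul, mul_one] at this
  omega

/-- Substituting the same element `y` in all the inputs, an operation acts through its class of
coinvariants. -/
theorem exists_linear_subst (hP : P.IsOperad) (m : ℕ) (y : P.Completion) :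
    ∃ G : P.Coinv m →ₗ[ℚ] P.Completion,
      ∀ p, G ((P.coinvKer m).mkQ p) = actFun p fun _ => y := by
  obtain ⟨F, hF⟩ := exists_linear_actFun (P := P) hP fun _ : Fin m => y
  refine ⟨(P.coinvKer m).liftQ F ?_, fun p => hF p⟩
  rw [coinvKer, Submodule.span_le]
  rintro _ ⟨σ, p, rfl⟩
  refine (map_sub F _ _).trans ?_
  rw [hF, hF, actFun_map hP, sub_self]

theorem prod_apply (hP : P.IsOperad) (x y : P.Completion) {N M : ℕ} (hM : N < M) :
    prod x y N = ∑ m ∈ Finset.range M, actFun (rep (x m)) (fun _ => y) N := by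
  unfold prod
  simp_rw [act_eq_actFun]
  refine Finset.sum_subset (fun n hn => ?_) (fun n _ hn => ?_)
  · simp only [Finset.mem_Icc, Finset.mem_range] at hn ⊢
    omega
  · rw [Finset.mem_Icc] at hn
    by_cases h0 : n = 0
    · subst h0
      obtain ⟨F, hF⟩ := exists_linear_actFun (P := P) hP fun _ : Fin 0 => y
      rw [eq_zero_of_isEmpty hP (rep (x 0)), ← hF, map_zero, Pi.zero_apply]
    · exact actFun_eq_zero_of_lt _ _ (by rw [Fintype.card_fin]; omega)

/-- The product may be computed with arbitrary representatives of the left factor. -/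
theorem prod_apply_of_mkQ (hP : P.IsOperad) {x : P.Completion} (y : P.Completion)
    {p : ∀ m, P.obj (Fin m)} (hp : ∀ m, (P.coinvKer m).mkQ (p m) = x m) (N : ℕ) :
    prod x y N = ∑ m ∈ Finset.Icc 1 N, actFun (p m) (fun _ => y) N := by
  unfold prod
  refine Finset.sum_congr rfl fun m _ => ?_
  obtain ⟨G, hG⟩ := exists_linear_subst hP m y
  rw [act_eq_actFun, ← hG, ← hG, mk_rep, hp]

theorem prod_congr {x x' : P.Completion} (y : P.Completion) {N : ℕ} (h : ∀ n ≤ N, x n = x' n) :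
    prod x y N = prod x' y N := by
  refine Finset.sum_congr rfl fun m hm => ?_
  rw [h m (Finset.mem_Icc.mp hm).2]

theorem prod_sum (hP : P.IsOperad) {α : Type} (A : Finset α) (w : α → P.Completion)
    (y : P.Completion) : prod (∑ l ∈ A, w l) y = ∑ l ∈ A, prod (w l) y := by
  funext N
  choose G hG using fun m => exists_linear_subst (P := P) hP m y
  have h (x : P.Completion) : prod x y N = ∑ m ∈ Finset.Icc 1 N, G m (x m) N :=
    Finset.sum_congr rfl fun m _ => by rw [act_eq_actFun, ← hG, mk_rep]
  simp only [h, Finset.sum_apply, map_sum]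
  exact Finset.sum_comm

theorem prod_clsAll (hP : P.IsOperad) {I : Type} [Fintype I] (p : P.obj I) (y : P.Completion) :
    prod (clsAll P p) y = actFun p fun _ => y := by
  funext N
  choose G hG using fun m => exists_linear_subst (P := P) hP m y
  rw [prod_apply hP (M := N + 1 + Fintype.card I + 1) _ _ (by omega),
    Finset.sum_eq_single (Fintype.card I)]
  · rw [← hG, mk_rep, clsAll, ← cls_map hP (Fintype.equivFin I), cls_eq_mkQ, hG, actFun_map hP]
  · intro m _ hm
    rw [← hG, mk_rep, clsAll, cls_of_card_ne (fun h => hm h.symm), map_zero, Pi.zero_apply]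
  · intro h
    exact absurd (Finset.mem_range.mpr (by omega)) h

/-- The map `x ↦ x × y` is a morphism of algebras over the operad. -/
theorem prod_actFun (hP : P.IsOperad) {I : Type} [Fintype I] (p : P.obj I) (w : I → P.Completion)
    (y : P.Completion) : prod (actFun p w) y = actFun p fun i => prod (w i) y := by
  classical
  funext N
  -- Up to degree `N`, both `actFun p w` and the `prod (w i) y` are finite sums, so that the claim
  -- reduces to the case of classes of operations, which is `actFun_comp`.
  rw [prod_congr y (fun n hn => actFun_eq_sum_clsAll hP p w (Nat.lt_succ_of_le hn)), prod_sum hP,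
    Finset.sum_apply, actFun_congr p (z := fun i => prod (w i) y)
      (w := fun i => ∑ n ∈ Finset.range (N + 1), actFun (rep (w i n)) (fun _ => y)) (N := N)
      (fun i n hn => by rw [prod_apply hP _ _ (Nat.lt_succ_of_le hn), Finset.sum_apply]),
    actFun_sum hP]
  refine Finset.sum_congr rfl fun n _ => ?_
  rw [prod_clsAll hP, ← actFun_comp hP]

/-- The product is associative: `x ↦ (x × y) × z` and `x ↦ x × (y × z)` both send `x` to the result of
substituting `y × z` in all its inputs. -/
theorem IsOperad.prod_assoc (hP : P.IsOperad) (x y z : P.Completion) :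
    prod (prod x y) z = prod x (prod y z) := by
  funext N
  rw [prod_congr (x' := ∑ m ∈ Finset.range (N + 1), actFun (rep (x m)) (fun _ => y)) z (N := N)
      (fun n hn => by rw [prod_apply hP _ _ (Nat.lt_succ_of_le hn), Finset.sum_apply]), prod_sum hP,
    prod_apply hP _ _ (Nat.lt_succ_self N), Finset.sum_apply]
  simp_rw [prod_actFun hP]

theorem one_eq_clsAll : P.one = clsAll P P.unit := rfl

theorem IsOperad.one_prod (hP : P.IsOperad) (x : P.Completion) : prod P.one x = x := by
  rw [one_eq_clsAll, prod_clsAll hP, actFun_unit hP]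

/-- Substituting the generator in all the inputs of an operation gives its class. -/
theorem actFun_one (hP : P.IsOperad) {I : Type} [Fintype I] (p : P.obj I) :
    actFun p (fun _ => P.one) = clsAll P p := by
  rw [one_eq_clsAll, actFun_clsAll hP]
  funext N
  rw [clsAll, ← cls_map hP (Equiv.sigmaUnique I fun _ => Unit), hP.comp_unit]
  rfl

theorem IsOperad.prod_one (hP : P.IsOperad) (x : P.Completion) : prod x P.one = x := by
  funext N
  simp_rw [prod_apply hP _ _ (Nat.lt_succ_self N), actFun_one hP]
  rw [Finset.sum_eq_single N]
  · exact cls_rep _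
  · intro m _ hm
    exact cls_of_card_ne (by rwa [Fintype.card_fin]) _
  · intro h
    exact absurd (Finset.mem_range.mpr (Nat.lt_succ_self N)) h

theorem IsOperad.isMonoid (hP : P.IsOperad) : P.IsMonoid :=
  ⟨hP.prod_assoc, fun x => ⟨hP.one_prod x, hP.prod_one x⟩⟩

/-- A right inverse and a left inverse of the same element coincide. -/
theorem IsMonoid.inverse_unique (hP : P.IsMonoid) {x y y' : P.Completion} (h : prod x y = P.one)
    (h' : prod y' x = P.one) : y = y' := by
  rw [← (hP.2 y).1, ← h', hP.1, h, (hP.2 y').2]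

/-- In the top degree only the linear part `c` of `x` contributes to the action of an operation of
arity `N`, so that it acts as multiplication by `c ^ N`. -/
theorem actFun_top (hP : P.IsOperad) {x : P.Completion} {c : ℚ} (hx : x 1 = c • P.one 1) {N : ℕ}
    (p : P.obj (Fin N)) : actFun p (fun _ => x) N = c ^ N • (P.coinvKer N).mkQ p := by
  classical
  -- As all the degrees are at least `1` and add up to `N`, they are all equal to `1`.
  have h (z : P.Completion) : actFun p (fun _ => z) N = cls N (P.comp p fun _ => rep (z 1)) := by
    refine (Finset.sum_eq_single (fun _ => 1) (fun n hn hn1 => ?_) (fun h => ?_))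
    · refine cls_of_card_ne ?_ _
      simp only [Fintype.mem_piFinset, Finset.mem_Icc] at hn
      obtain ⟨i, hi⟩ := Function.ne_iff.mp hn1
      rw [Fintype.card_sigma]
      have := Finset.sum_lt_sum (s := Finset.univ) (f := fun _ : Fin N => 1)
        (g := fun i => Fintype.card (Fin (n i)))
        (fun i _ => by rw [Fintype.card_fin]; exact (hn i).1)
        ⟨i, Finset.mem_univ _, by rw [Fintype.card_fin]; exact lt_of_le_of_ne (hn i).1 (Ne.symm hi)⟩
      simp only [Finset.sum_const, Finset.card_univ, smul_eq_mul, mul_one, Fintype.card_fin] at this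
      simp only [Fintype.card_fin]
      omega
    · refine absurd ((@Fintype.mem_piFinset _ (Classical.decEq _) _ _ _ _).mpr fun i =>
        Finset.mem_Icc.mpr ⟨le_rfl, ?_⟩) h
      exact i.pos
  obtain ⟨F, hF⟩ := exists_multilinear_coinv (P := P) hP N (fun _ : Fin N => 1)
  have h1 := h P.one
  rw [actFun_one hP, ← hF, clsAll, cls_eq_mkQ] at h1
  -- For `x` the unit the value is the class of `p`; the general case follows by multilinearity.
  rw [h, ← hF, hx, h1]
  refine ((F p).map_smul_univ (fun _ => c) fun _ => P.one 1).trans ?_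
  rw [Finset.prod_const, Finset.card_univ, Fintype.card_fin]

/-- The equation `y × x = 1` is triangular in the components of `y`, and can be solved when the
linear part of `x` is a nonzero multiple of the unit. -/
theorem exists_prod_eq_one (hP : P.IsOperad) {x : P.Completion} {c : ℚ} (hc : c ≠ 0)
    (hx : x 1 = c • P.one 1) : ∃ y, prod y x = P.one ∧ y 1 = c⁻¹ • P.one 1 := by
  -- In degree `N` the equation reads `c ^ N • y N + ⋯ = one N`, the omitted terms involving only the
  -- components of `y` in degrees less than `N`.
  let step (N : ℕ) (ih : ∀ m, m < N → P.Coinv m) : P.Coinv N :=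
    (c ^ N)⁻¹ • (P.one N - ∑ m : Fin N, actFun (rep (ih m m.2)) (fun _ => x) N)
  let y : P.Completion := fun N => Nat.strongRec (motive := fun n => P.Coinv n) step N
  have hy (N : ℕ) : y N =
      (c ^ N)⁻¹ • (P.one N - ∑ m : Fin N, actFun (rep (y m)) (fun _ => x) N) := by
    change Nat.strongRec (motive := fun n => P.Coinv n) step N = _
    rw [Nat.strongRec_eq]
  have h : prod y x = P.one := by
    funext N
    rw [prod_apply hP _ _ (Nat.lt_succ_self N), Finset.sum_range_succ, actFun_top hP hx, mk_rep, hy N,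
      smul_inv_smul₀ (pow_ne_zero _ hc), Finset.sum_range]
    abel
  refine ⟨y, h, ?_⟩
  have h1 := congrFun h 1
  rw [prod_apply_of_mkQ hP x (fun m => mk_rep (y m)), Finset.Icc_self, Finset.sum_singleton,
    actFun_top hP hx, mk_rep, pow_one] at h1
  rw [← h1, inv_smul_smul₀ hc]

/-- An element whose linear part is a nonzero multiple of the unit is invertible: it has a left
inverse, which has itself a left inverse. -/
theorem mem_G_of_linear_part (hP : P.IsOperad) {x : P.Completion} {c : ℚ} (hc : c ≠ 0)
    (hx : x 1 = c • P.one 1) : x ∈ P.G := by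
  obtain ⟨y, hy, hy1⟩ := exists_prod_eq_one hP hc hx
  obtain ⟨z, hz, -⟩ := exists_prod_eq_one hP (inv_ne_zero hc) hy1
  rw [← hP.isMonoid.inverse_unique hy hz] at hz
  exact ⟨y, hz, hy⟩

end OperadData

/-! ### The axioms for the pre-Lie operad -/

theorem Fintype.sum_ite_of_unique {α : Type*} [Fintype α] (p : α → Prop) [DecidablePred p]
    [Decidable (∃ a, p a)] (h : ∀ a b, p a → p b → a = b) (c : ℚ) :
    (∑ a, if p a then c else 0) = if ∃ a, p a then c else 0 := by
  split_ifs with hp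
  · obtain ⟨a, ha⟩ := hp
    rw [Finset.sum_eq_single a, if_pos ha]
    · exact fun b _ hb => if_neg fun hpb => hb (h b a hpb ha)
    · exact fun ha => absurd (Finset.mem_univ a) ha
  · exact Finset.sum_eq_zero fun a _ => if_neg fun ha => hp ⟨a, ha⟩

namespace PreLie

open LabelledTree

open Classical in
/-- The coefficient of `V` in `γ(γ(p; q); r)`, as a sum over the trees `T`, `S i` and `R i j` from which
`V` arises; the intermediate tree `U` is determined by them. -/
theorem coeff_comp_comp {I : Type} [Fintype I] {J : I → Type} [∀ i, Fintype (J i)]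
    {K : ∀ i, J i → Type} [∀ i j, Fintype (K i j)] (p : PreLie.obj I) (q : ∀ i, PreLie.obj (J i))
    (r : ∀ i j, PreLie.obj (K i j)) (V : LabelledTree (Σ a : (Σ i, J i), K a.1 a.2)) :
    coeff V (PreLie.comp (PreLie.comp p q) fun a : Σ i, J i => r a.1 a.2) =
      ∑ T : LabelledTree I, ∑ S : ∀ i, LabelledTree (J i), ∑ R : ∀ i j, LabelledTree (K i j),
        if ∃ U, IsGraft V U (fun a => R a.1 a.2) ∧ IsGraft U T S then
          coeff T p * ∏ i, (coeff (S i) (q i) * ∏ j, coeff (R i j) (r i j)) else 0 := by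
  rw [coeff_comp, Finset.sum_comm]
  simp_rw [coeff_comp]
  have h1 (R : ∀ a : Σ i, J i, LabelledTree (K a.1 a.2)) :
      (∑ U : LabelledTree (Σ i, J i), if IsGraft V U R then
        (∑ T : LabelledTree I, ∑ S : ∀ i, LabelledTree (J i),
          if IsGraft U T S then coeff T p * ∏ i, coeff (S i) (q i) else 0) *
            ∏ a : Σ i, J i, coeff (R a) (r a.1 a.2) else 0) =
      ∑ T : LabelledTree I, ∑ S : ∀ i, LabelledTree (J i),
        if ∃ U, IsGraft V U R ∧ IsGraft U T S then
          coeff T p * ∏ i, (coeff (S i) (q i) * ∏ j, coeff (R ⟨i, j⟩) (r i j)) else 0 := by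
    have h2 (U : LabelledTree (Σ i, J i)) : (if IsGraft V U R then
        (∑ T : LabelledTree I, ∑ S : ∀ i, LabelledTree (J i),
          if IsGraft U T S then coeff T p * ∏ i, coeff (S i) (q i) else 0) *
            ∏ a : Σ i, J i, coeff (R a) (r a.1 a.2) else 0) =
        ∑ T : LabelledTree I, ∑ S : ∀ i, LabelledTree (J i),
          if IsGraft V U R ∧ IsGraft U T S then
            coeff T p * ∏ i, (coeff (S i) (q i) * ∏ j, coeff (R ⟨i, j⟩) (r i j)) else 0 := by
      split_ifs with h
      · simp only [h, true_and, Finset.sum_mul, ite_mul, zero_mul, Finset.prod_mul_distrib,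
          Fintype.prod_sigma, mul_assoc]
      · simp [h]
    simp_rw [h2]
    rw [Finset.sum_comm]
    refine Finset.sum_congr rfl fun T _ => ?_
    rw [Finset.sum_comm]
    refine Finset.sum_congr rfl fun S _ => ?_
    exact Fintype.sum_ite_of_unique _ (fun U U' h h' => h.1.outer_unique h'.1) _
  simp_rw [h1]
  rw [Finset.sum_comm]
  refine Finset.sum_congr rfl fun T _ => ?_
  rw [Finset.sum_comm]
  refine Finset.sum_congr rfl fun S _ => ?_
  exact Finset.sum_equiv (Equiv.piCurry fun i j => LabelledTree (K i j))
    (fun _ => by simp) fun R _ => rfl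

open Classical in
/-- The coefficient of `V` in `γ(p; γ(q; r))`, as a sum over the same triples of trees as in
`coeff_comp_comp`; the intermediate trees `W i` are determined by them. -/
theorem coeff_comp_of_comp {I : Type} [Fintype I] {J : I → Type} [∀ i, Fintype (J i)]
    {K : ∀ i, J i → Type} [∀ i j, Fintype (K i j)] (p : PreLie.obj I) (q : ∀ i, PreLie.obj (J i))
    (r : ∀ i j, PreLie.obj (K i j)) (V : LabelledTree (Σ i, Σ j, K i j)) :
    coeff V (PreLie.comp p fun i => PreLie.comp (q i) (r i)) =
      ∑ T : LabelledTree I, ∑ S : ∀ i, LabelledTree (J i), ∑ R : ∀ i j, LabelledTree (K i j),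
        if ∃ W : ∀ i, LabelledTree (Σ j, K i j), IsGraft V T W ∧ ∀ i, IsGraft (W i) (S i) (R i) then
          coeff T p * ∏ i, (coeff (S i) (q i) * ∏ j, coeff (R i j) (r i j)) else 0 := by
  rw [coeff_comp]
  refine Finset.sum_congr rfl fun T _ => ?_
  simp_rw [coeff_comp, Finset.prod_univ_sum, Fintype.piFinset_univ, Finset.prod_ite_zero,
    Finset.mem_univ, true_imp_iff]
  have h2 (W : ∀ i, LabelledTree (Σ j, K i j)) : (if IsGraft V T W then
      coeff T p * ∑ S : ∀ i, LabelledTree (J i), ∑ R : ∀ i j, LabelledTree (K i j),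
        (if ∀ i, IsGraft (W i) (S i) (R i) then
          ∏ i, (coeff (S i) (q i) * ∏ j, coeff (R i j) (r i j)) else 0) else 0) =
      ∑ S : ∀ i, LabelledTree (J i), ∑ R : ∀ i j, LabelledTree (K i j),
        if IsGraft V T W ∧ ∀ i, IsGraft (W i) (S i) (R i) then
          coeff T p * ∏ i, (coeff (S i) (q i) * ∏ j, coeff (R i j) (r i j)) else 0 := by
    split_ifs with h
    · simp only [h, true_and, Finset.mul_sum, mul_ite, mul_zero]
    · simp [h]
  simp_rw [h2]
  rw [Finset.sum_comm]
  refine Finset.sum_congr rfl fun S _ => ?_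
  rw [Finset.sum_comm]
  refine Finset.sum_congr rfl fun R _ => ?_
  exact Fintype.sum_ite_of_unique _ (fun W W' h h' => h.1.inner_unique h'.1
    fun i => (h.2 i).root_eq.trans (h'.2 i).root_eq.symm) _

theorem relabel_surjective {I I' : Type} (e : I ≃ I') :
    Function.Surjective (LabelledTree.relabel e) := (relabelEquiv e).surjective

theorem eq_point (T : LabelledTree Unit) : T = point := by
  ext

open Classical in
theorem coeff_unit (T : LabelledTree Unit) : coeff T PreLie.unit = 1 := by
  rw [eq_point T]
  exact Finsupp.single_eq_same

/-- Replacing the vertex of the one-vertex tree by `S ()` gives `S ()`. -/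
theorem isGraft_point {J : Unit → Type} (U : LabelledTree (Σ i, J i)) (S : ∀ i, LabelledTree (J i)) :
    IsGraft U point S ↔ U.relabel (Equiv.uniqueSigma J) = S () := by
  constructor
  · intro h
    refine LabelledTree.ext ?_ (funext fun j => ?_)
    · rw [relabel_root, h.root_eq]
      rfl
    · obtain ⟨⟨⟨⟩, j⟩, rfl⟩ := (Equiv.uniqueSigma J).surjective j
      rw [relabel_parent]
      by_cases hj : j = (S ()).root
      · subst hj
        have := h.root_eq
        change U.root = ⟨(), (S ()).root⟩ at this
        rw [← this, U.parent_root, this]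
        exact (S ()).parent_root.symm
      · rw [h.parent_eq () j hj]
        rfl
  · intro h
    refine ⟨(Equiv.uniqueSigma J).injective ?_, fun i j _ => (Equiv.uniqueSigma J).injective ?_,
      fun i hi => absurd rfl hi⟩
    · rw [← relabel_root, h]
      rfl
    · rw [← relabel_parent, h]
      rfl

/-- Replacing every vertex of `T` by a one-vertex tree gives `T`. -/
theorem isGraft_points {I : Type} (U : LabelledTree (Σ _ : I, Unit)) (T : LabelledTree I) :
    IsGraft U T (fun _ => point) ↔ U.relabel (Equiv.sigmaUnique I fun _ => Unit) = T := by
  constructor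
  · intro h
    refine LabelledTree.ext ?_ (funext fun i => ?_)
    · rw [relabel_root, h.root_eq]
      rfl
    · by_cases hi : i = T.root
      · subst hi
        rw [T.parent_root]
        have := (U.relabel (Equiv.sigmaUnique I fun _ => Unit)).parent_root
        rwa [relabel_root, h.root_eq] at this
      · rw [← h.parent_fst i hi]
        rfl
  · rintro rfl
    exact ⟨rfl, fun i j hj => absurd rfl hj, fun i hi => rfl⟩

theorem isOperad : PreLie.IsOperad where
  map_refl p := by
    ext T
    exact coeff_map (Equiv.refl _) T p
  map_trans e e' p := by
    ext T
    obtain ⟨T, rfl⟩ := relabel_surjective (e.trans e') T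
    rw [coeff_map, ← relabel_trans, coeff_map, coeff_map]
  subsingleton I _ := ⟨fun x y => by
    ext T
    exact isEmptyElim T.root⟩
  exists_multilinear {I} _ J _ := by
    classical
    refine ⟨∑ T : LabelledTree I, ∑ S : ∀ i, LabelledTree (J i), (coeff T).smulRight
      (((MultilinearMap.mkPiAlgebra ℚ I ℚ).compLinearMap fun i => coeff (S i)).smulRight
        (∑ f : T.AttachMap J, ofTree (T.graft S f))),
      fun p q => ?_⟩
    simp_rw [comp_eq_sum, LinearMap.sum_apply, sum_apply, mul_smul]
    rfl
  comp_map_left {I I'} _ _ {J} _ e p q := by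
    classical
    ext U
    obtain ⟨U, rfl⟩ := relabel_surjective (Equiv.sigmaCongrLeft e) U
    rw [coeff_map, coeff_comp, coeff_comp]
    refine (Fintype.sum_equiv (relabelEquiv e) _ _ fun T => ?_).symm
    refine Finset.sum_equiv (Equiv.piCongrLeft (fun i => LabelledTree (J i)) e)
      (fun _ => by simp) fun S _ => ?_
    obtain ⟨S, rfl⟩ := (Equiv.piCongrLeft (fun i => LabelledTree (J i)) e).symm.surjective S
    rw [Equiv.apply_symm_apply]
    change (if IsGraft U T (fun i => S (e i)) then coeff T p * ∏ i, coeff (S (e i)) (q (e i)) else 0) =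
      if IsGraft _ (T.relabel e) S then coeff (T.relabel e) _ * _ else 0
    rw [isGraft_relabel_outer, coeff_map, ← Equiv.prod_comp e]
  comp_map_right {I} _ {J J'} _ _ p e q := by
    classical
    ext U
    obtain ⟨U, rfl⟩ := relabel_surjective (Equiv.sigmaCongrRight e) U
    rw [coeff_map, coeff_comp, coeff_comp]
    refine Finset.sum_congr rfl fun T _ => ?_
    refine (Fintype.sum_equiv (Equiv.piCongrRight fun i => relabelEquiv (e i)) _ _ fun S => ?_).symm
    change _ = if IsGraft _ T (fun i => (S i).relabel (e i)) then
      coeff T p * ∏ i, coeff ((S i).relabel (e i)) _ else 0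
    simp_rw [isGraft_relabel_inner, coeff_map]
  comp_assoc {I} _ {J} _ {K} _ p q r := by
    classical
    ext V
    obtain ⟨V, rfl⟩ := relabel_surjective (Equiv.sigmaAssoc K) V
    rw [coeff_map, coeff_comp_comp, coeff_comp_of_comp]
    simp_rw [exists_isGraft_assoc]
  unit_comp {J} _ q := by
    classical
    ext U
    obtain ⟨U, rfl⟩ := relabel_surjective (Equiv.uniqueSigma J) U
    rw [coeff_map, coeff_comp, Fintype.sum_eq_single point (fun T h => absurd (eq_point T) h),
      coeff_unit]
    simp_rw [isGraft_point]
    rw [Finset.sum_eq_single fun _ => U.relabel (Equiv.uniqueSigma J), if_pos rfl]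
    · simp
    · intro S _ hS
      rw [if_neg]
      intro h
      exact hS (funext fun _ => h.symm)
    · exact fun h => absurd (by simp) h
  comp_unit {I} _ p := by
    classical
    ext U
    obtain ⟨U, rfl⟩ := relabel_surjective (Equiv.sigmaUnique I fun _ => Unit) U
    rw [coeff_map, coeff_comp]
    have h (T : LabelledTree I) : (∑ S : ∀ _ : I, LabelledTree Unit, if IsGraft U T S then
        coeff T p * ∏ i, coeff (S i) PreLie.unit else 0) =
        if U.relabel (Equiv.sigmaUnique I fun _ => Unit) = T then coeff T p else 0 := by
      rw [Fintype.sum_eq_single (fun _ => point)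
        (fun S h => absurd (funext fun i => eq_point (S i)) h)]
      simp_rw [isGraft_points, coeff_unit, Finset.prod_const_one, mul_one]
    simp_rw [h]
    rw [Finset.sum_ite_eq, if_pos (Finset.mem_univ _)]

end PreLie

/-! ### Linear trees -/

namespace LabelledTree

variable {I I' : Type}

theorem isLinear_relabel (e : I ≃ I') (T : LabelledTree I) :
    (T.relabel e).IsLinear ↔ T.IsLinear := by
  refine ⟨IsLinear.of_relabel, fun h => IsLinear.of_relabel (e := e.symm) ?_⟩
  rw [relabel_trans, Equiv.self_trans_symm, relabel_refl]
  exact h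

theorem parent_ne_self (T : LabelledTree I) {i : I} (hi : i ≠ T.root) : T.parent i ≠ i := by
  intro h
  obtain ⟨k, hk⟩ := T.reaches_root i
  rw [Function.iterate_fixed h] at hk
  exact hi hk

/-- A finite linear tree has exactly one vertex without incoming edges: its parent function is
injective away from the root, so that it misses exactly one vertex. -/
theorem IsLinear.exists_top [Finite I] {T : LabelledTree I} (hT : T.IsLinear) :
    ∃ t, ∀ k, (∀ i, i ≠ T.root → T.parent i ≠ k) ↔ k = t := by
  classical
  have := Fintype.ofFinite I
  have hc : ((Finset.univ.erase T.root).image T.parent)ᶜ.card = 1 := by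
    rw [Finset.card_compl, Finset.card_image_of_injOn, Finset.card_erase_of_mem (Finset.mem_univ _),
      Finset.card_univ]
    · have : 0 < Fintype.card I := Fintype.card_pos_iff.mpr ⟨T.root⟩
      omega
    · intro i hi j hj h
      simp only [Finset.coe_erase, Finset.coe_univ, Set.mem_sdiff, Set.mem_univ, Set.mem_singleton_iff,
        true_and] at hi hj
      exact hT i j hi hj h
  obtain ⟨t, ht⟩ := Finset.card_eq_one.mp hc
  refine ⟨t, fun k => ?_⟩
  rw [← Finset.mem_singleton, ← ht]
  simp

/-- The distance of a vertex to the root. -/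
def depth (T : LabelledTree I) (i : I) : ℕ :=
  open Classical in Nat.find (T.reaches_root i)

theorem depth_root (T : LabelledTree I) : T.depth T.root = 0 := by
  classical
  exact (Nat.find_eq_zero _).mpr rfl

theorem depth_eq_succ (T : LabelledTree I) {i : I} (hi : i ≠ T.root) :
    T.depth i = T.depth (T.parent i) + 1 := by
  classical
  exact Nat.find_comp_succ (T.reaches_root i) (T.reaches_root (T.parent i)) hi

theorem IsLinear.depth_injective {T : LabelledTree I} (hT : T.IsLinear) :
    Function.Injective T.depth := by
  have key : ∀ n i j, T.depth i = n → T.depth j = n → i = j := by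
    intro n
    induction n with
    | zero =>
      have h : ∀ i, T.depth i = 0 → i = T.root := by
        intro i hi
        by_contra hne
        rw [T.depth_eq_succ hne] at hi
        omega
      intro i j hi hj
      rw [h i hi, h j hj]
    | succ n ih =>
      have h : ∀ i, T.depth i = n + 1 → i ≠ T.root := by
        rintro _ hi rfl
        rw [T.depth_root] at hi
        omega
      intro i j hi hj
      refine hT i j (h i hi) (h j hj) (ih _ _ ?_ ?_)
      · rw [T.depth_eq_succ (h i hi)] at hi
        omega
      · rw [T.depth_eq_succ (h j hj)] at hj
        omega
  exact fun i j h => key _ i j rfl h.symm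

theorem exists_depth_eq (T : LabelledTree I) {n : ℕ} {i : I} (hi : T.depth i = n) {m : ℕ}
    (hm : m ≤ n) : ∃ j, T.depth j = m := by
  induction n generalizing i with
  | zero => exact ⟨i, by omega⟩
  | succ n ih =>
    by_cases h : m = n + 1
    · exact ⟨i, by omega⟩
    · have hne : i ≠ T.root := by
        rintro rfl
        rw [T.depth_root] at hi
        omega
      rw [T.depth_eq_succ hne] at hi
      exact ih (i := T.parent i) (by omega) (by omega)

/-- Every linear tree is isomorphic to a standard one, the vertices being numbered by their distance
to the root. -/
theorem IsLinear.exists_eq_relabel_ladder [Fintype I] {T : LabelledTree I} (hT : T.IsLinear) {n : ℕ}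
    (hn : Fintype.card I = n + 1) : ∃ e : Fin (n + 1) ≃ I, T = (ladder n).relabel e := by
  classical
  -- The depths are pairwise distinct and form an initial segment of `ℕ`, hence are `0, …, n`.
  have hb : ∀ i, T.depth i < n + 1 := by
    intro i
    by_contra! h
    have hsub : Finset.range (n + 2) ⊆ Finset.univ.image T.depth := by
      intro m hm
      obtain ⟨j, hj⟩ := T.exists_depth_eq (i := i) rfl (m := m) (by
        have := Finset.mem_range.mp hm
        omega)
      exact Finset.mem_image.mpr ⟨j, Finset.mem_univ _, hj⟩
    have := (Finset.card_le_card hsub).trans Finset.card_image_le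
    rw [Finset.card_range, Finset.card_univ, hn] at this
    omega
  let d : I → Fin (n + 1) := fun i => ⟨T.depth i, hb i⟩
  have hd : Function.Bijective d := by
    rw [Fintype.bijective_iff_injective_and_card]
    exact ⟨fun i j h => hT.depth_injective (Fin.ext_iff.mp h), by rw [hn, Fintype.card_fin]⟩
  let e := Equiv.ofBijective d hd
  have key : T.relabel e = ladder n := by
    refine LabelledTree.ext (Fin.ext T.depth_root) (funext fun k => ?_)
    obtain ⟨i, rfl⟩ := e.surjective k
    rw [relabel_parent]
    refine Fin.ext ?_
    change T.depth (T.parent i) = T.depth i - 1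
    by_cases hi : i = T.root
    · rw [hi, T.parent_root, T.depth_root]
    · rw [T.depth_eq_succ hi]
      rfl
  refine ⟨e.symm, ?_⟩
  rw [← key, relabel_trans, Equiv.self_trans_symm, relabel_refl]

theorem isLinear_ladder (n : ℕ) : (ladder n).IsLinear := by
  intro i j hi hj h
  have h' : (i : ℕ) - 1 = (j : ℕ) - 1 := congrArg Fin.val h
  have hi' : (i : ℕ) ≠ 0 := fun h => hi (Fin.ext h)
  have hj' : (j : ℕ) ≠ 0 := fun h => hj (Fin.ext h)
  exact Fin.ext (by omega)

theorem isLinear_edge : edge.IsLinear := by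
  intro i j hi hj _
  have hi' : (i : ℕ) ≠ 0 := fun h => hi (Fin.ext h)
  have hj' : (j : ℕ) ≠ 0 := fun h => hj (Fin.ext h)
  exact Fin.ext (by omega)

theorem isLinear_point : point.IsLinear := fun _ _ _ _ _ => rfl

section Graft

variable {J : I → Type}

theorem ne_root_graft {U : LabelledTree (Σ i, J i)} {T : LabelledTree I}
    {S : ∀ i, LabelledTree (J i)} (h : IsGraft U T S) {i : I} {j : J i}
    (hij : i ≠ T.root ∨ j ≠ (S i).root) : (⟨i, j⟩ : Σ i, J i) ≠ U.root := by
  rw [h.root_eq]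
  intro h
  rw [Sigma.mk.injEq] at h
  obtain ⟨rfl, h⟩ := h
  obtain rfl := eq_of_heq h
  exact hij.elim (fun h => h rfl) (fun h => h rfl)

/-- If replacing vertices by trees gives a linear tree, the replacing trees are linear. -/
theorem IsGraft.isLinear_inner {U : LabelledTree (Σ i, J i)} {T : LabelledTree I}
    {S : ∀ i, LabelledTree (J i)} (h : IsGraft U T S) (hU : U.IsLinear) (i : I) :
    (S i).IsLinear := by
  intro j j' hj hj' hjj
  have := hU ⟨i, j⟩ ⟨i, j'⟩ (ne_root_graft h (.inr hj)) (ne_root_graft h (.inr hj'))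
    (by rw [h.parent_eq i j hj, h.parent_eq i j' hj', hjj])
  simpa using this

/-- In a linear tree obtained by replacing vertices by trees, the incoming edge of a vertex is
attached to the vertex of the replacing tree that has no incoming edge. -/
theorem IsGraft.parent_top {U : LabelledTree (Σ i, J i)} {T : LabelledTree I}
    {S : ∀ i, LabelledTree (J i)} (h : IsGraft U T S) (hU : U.IsLinear) {t : ∀ i, J i}
    (ht : ∀ i k, (∀ j, j ≠ (S i).root → (S i).parent j ≠ k) ↔ k = t i) {i : I} (hi : i ≠ T.root) :
    U.parent ⟨i, (S i).root⟩ = ⟨T.parent i, t (T.parent i)⟩ := by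
  have hU' : U.parent ⟨i, (S i).root⟩ = ⟨T.parent i, cast (congrArg J (h.parent_fst i hi))
      (U.parent ⟨i, (S i).root⟩).2⟩ := by
    refine Sigma.ext (h.parent_fst i hi) ?_
    exact (cast_heq _ _).symm
  rw [hU']
  generalize cast _ _ = k at hU'
  congr 1
  rw [← ht]
  rintro j hj rfl
  rw [← h.parent_eq _ j hj] at hU'
  have := hU _ _ (ne_root_graft h (.inl hi)) (ne_root_graft h (.inr hj)) hU'
  exact T.parent_ne_self hi (congrArg Sigma.fst this).symm

theorem IsGraft.isLinear_outer [∀ i, Finite (J i)] {U : LabelledTree (Σ i, J i)}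
    {T : LabelledTree I} {S : ∀ i, LabelledTree (J i)} (h : IsGraft U T S) (hU : U.IsLinear) :
    T.IsLinear := by
  choose t ht using fun i => (h.isLinear_inner hU i).exists_top
  intro i i' hi hi' hii
  have := hU _ _ (ne_root_graft h (.inl hi)) (ne_root_graft h (.inl hi'))
    (by rw [h.parent_top hU ht hi, h.parent_top hU ht hi', hii])
  exact congrArg Sigma.fst this

/-- There is exactly one way of replacing the vertices of a linear tree by linear trees such that the
result is linear. -/
theorem existsUnique_isGraft_isLinear [∀ i, Finite (J i)] {T : LabelledTree I}
    {S : ∀ i, LabelledTree (J i)} (hT : T.IsLinear) (hS : ∀ i, (S i).IsLinear) :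
    ∃! U, IsGraft U T S ∧ U.IsLinear := by
  choose t ht using fun i => (hS i).exists_top
  have htop : ∀ i j, j ≠ (S i).root → (S i).parent j ≠ t i := fun i => (ht i (t i)).mpr rfl
  refine ⟨T.graft S fun i => t (T.parent i), ⟨isGraft_graft _ _ _, ?_⟩, ?_⟩
  · rintro ⟨i, j⟩ ⟨i', j'⟩ h h' hp
    by_cases hj : j = (S i).root
    · subst hj
      have hi : i ≠ T.root := by
        rintro rfl
        exact h rfl
      rw [graft_parent_root T S _ i hi] at hp
      by_cases hj' : j' = (S i').root
      · subst hj'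
        have hi' : i' ≠ T.root := by
          rintro rfl
          exact h' rfl
        rw [graft_parent_root T S _ i' hi'] at hp
        obtain rfl := hT i i' hi hi' (congrArg Sigma.fst hp)
        rfl
      · rw [(isGraft_graft T S _).parent_eq i' j' hj', Sigma.mk.injEq] at hp
        obtain ⟨rfl, hp⟩ := hp
        exact absurd (eq_of_heq hp).symm (htop _ j' hj')
    · rw [(isGraft_graft T S _).parent_eq i j hj] at hp
      by_cases hj' : j' = (S i').root
      · subst hj'
        have hi' : i' ≠ T.root := by
          rintro rfl
          exact h' rfl
        rw [graft_parent_root T S _ i' hi', Sigma.mk.injEq] at hp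
        obtain ⟨rfl, hp⟩ := hp
        exact absurd (eq_of_heq hp) (htop _ j hj)
      · rw [(isGraft_graft T S _).parent_eq i' j' hj', Sigma.mk.injEq] at hp
        obtain ⟨rfl, hp⟩ := hp
        rw [hS i j j' hj hj' (eq_of_heq hp)]
  · rintro U ⟨hU, hlin⟩
    obtain ⟨f, rfl⟩ := hU.exists_graft
    congr 1
    funext ⟨i, hi⟩
    have := hU.parent_top hlin ht hi
    rw [graft_parent_root T S f i hi] at this
    simpa using this

end Graft

end LabelledTree

namespace PreLie

open LabelledTree

open Classical in
/-- The sum of the coefficients of the linear trees. -/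
def linearSum (I : Type) [Finite I] : PreLie.obj I →ₗ[ℚ] ℚ :=
  ∑ T : LabelledTree I with T.IsLinear, coeff T

open Classical in
theorem linearSum_apply {I : Type} [Finite I] (p : PreLie.obj I) :
    linearSum I p = ∑ T : LabelledTree I, if T.IsLinear then coeff T p else 0 := by
  rw [linearSum, LinearMap.sum_apply, Finset.sum_filter]

theorem linearSum_map {I I' : Type} [Finite I] [Finite I'] (e : I ≃ I') (p : PreLie.obj I) :
    linearSum I' (PreLie.map e p) = linearSum I p := by
  classical
  rw [linearSum_apply, linearSum_apply]
  refine (Fintype.sum_equiv (relabelEquiv e) _ _ fun T => ?_).symm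
  change _ = if (T.relabel e).IsLinear then coeff (T.relabel e) _ else 0
  simp_rw [isLinear_relabel, coeff_map]

theorem linearSum_ofTree {I : Type} [Finite I] {T : LabelledTree I} (hT : T.IsLinear) :
    linearSum I (ofTree T) = 1 := by
  classical
  rw [linearSum_apply, Fintype.sum_eq_single T]
  · rw [if_pos hT, coeff_ofTree, if_pos rfl]
  · intro U hU
    rw [coeff_ofTree, if_neg hU.symm, ite_self]

/-- The sum of the coefficients of the linear trees is multiplicative, since exactly one of the trees
in a composition of linear trees is linear. -/
theorem linearSum_comp {I : Type} [Fintype I] {J : I → Type} [∀ i, Fintype (J i)]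
    (p : PreLie.obj I) (q : ∀ i, PreLie.obj (J i)) :
    linearSum (Σ i, J i) (PreLie.comp p q) = linearSum I p * ∏ i, linearSum (J i) (q i) := by
  classical
  simp_rw [linearSum_apply, coeff_comp, Finset.prod_univ_sum, Fintype.piFinset_univ,
    Finset.prod_ite_zero, Finset.mem_univ, true_imp_iff, Finset.sum_mul_sum]
  have h (U : LabelledTree (Σ i, J i)) : (if U.IsLinear then
      ∑ T : LabelledTree I, ∑ S : ∀ i, LabelledTree (J i),
        (if IsGraft U T S then coeff T p * ∏ i, coeff (S i) (q i) else 0) else 0) =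
      ∑ T : LabelledTree I, ∑ S : ∀ i, LabelledTree (J i),
        if IsGraft U T S ∧ U.IsLinear then coeff T p * ∏ i, coeff (S i) (q i) else 0 := by
    split_ifs with h <;> simp [h]
  simp_rw [h]
  rw [Finset.sum_comm]
  refine Finset.sum_congr rfl fun T _ => ?_
  rw [Finset.sum_comm]
  refine Finset.sum_congr rfl fun S _ => ?_
  by_cases hT : T.IsLinear ∧ ∀ i, (S i).IsLinear
  · have hu := existsUnique_isGraft_isLinear hT.1 hT.2
    rw [Fintype.sum_ite_of_unique _ (fun a b ha hb => hu.unique ha hb), if_pos hu.exists,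
      if_pos hT.1, if_pos hT.2]
  · rw [Finset.sum_eq_zero]
    · rw [not_and_or] at hT
      rcases hT with hT | hT <;> simp [hT]
    · intro U _
      rw [if_neg]
      rintro ⟨hg, hU⟩
      exact hT ⟨hg.isLinear_outer hU, hg.isLinear_inner hU⟩

theorem linearSum_eq_zero_of_isEmpty {I : Type} [Finite I] [IsEmpty I] (p : PreLie.obj I) :
    linearSum I p = 0 := by
  classical
  rw [linearSum_apply]
  exact Finset.sum_eq_zero fun T _ => isEmptyElim T.root

open Classical in
theorem eq_sum_ofTree {I : Type} [Finite I] (p : PreLie.obj I) :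
    p = ∑ T : LabelledTree I, coeff T p • ofTree T := by
  ext U
  rw [map_sum, Fintype.sum_eq_single U]
  · rw [map_smul, coeff_ofTree, if_pos rfl, smul_eq_mul, mul_one]
  · intro T hT
    rw [map_smul, coeff_ofTree, if_neg hT, smul_zero]

theorem mem_nonLinear_iff {I : Type} [Finite I] (p : PreLie.obj I) :
    p ∈ nonLinear I ↔ ∀ T : LabelledTree I, T.IsLinear → coeff T p = 0 := by
  classical
  constructor
  · intro hp T hT
    change p ∈ LinearMap.ker (coeff T)
    revert p
    change nonLinear I ≤ _
    rw [nonLinear, Submodule.span_le]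
    rintro _ ⟨U, hU, rfl⟩
    change coeff T (ofTree U) = 0
    rw [coeff_ofTree, if_neg]
    rintro rfl
    exact hU hT
  · intro h
    rw [eq_sum_ofTree p]
    refine Submodule.sum_mem _ fun T _ => ?_
    by_cases hT : T.IsLinear
    · rw [h T hT, zero_smul]
      exact Submodule.zero_mem _
    · exact Submodule.smul_mem _ _ (Submodule.subset_span ⟨T, hT, rfl⟩)

end PreLie

/-! ### Power series counting linear trees, and the associative operad -/

namespace PreLie

open LabelledTree OperadData

/-- The sum of the coefficients of the linear trees in a class of coinvariants. -/
def linearCoeff (n : ℕ) : PreLie.Coinv n →ₗ[ℚ] ℚ :=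
  (PreLie.coinvKer n).liftQ (linearSum (Fin n)) (by
    rw [OperadData.coinvKer, Submodule.span_le]
    rintro _ ⟨σ, x, rfl⟩
    exact (map_sub (linearSum (Fin n)) _ _).trans (sub_eq_zero.mpr (linearSum_map σ x)))

theorem linearCoeff_mkQ {n : ℕ} (p : PreLie.obj (Fin n)) :
    linearCoeff n ((PreLie.coinvKer n).mkQ p) = linearSum (Fin n) p := rfl

theorem linearCoeff_cls {I : Type} [Fintype I] (N : ℕ) (p : PreLie.obj I) :
    linearCoeff N (cls N p) = if Fintype.card I = N then linearSum I p else 0 := by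
  split_ifs with h
  · rw [cls, dif_pos h]
    exact (linearCoeff_mkQ _).trans (linearSum_map _ _)
  · rw [cls_of_card_ne h, map_zero]

/-- The power series whose coefficients are the sums of the coefficients of the linear trees with a
given number of vertices. -/
def linearSeries (x : PreLie.Completion) : PowerSeries ℚ :=
  PowerSeries.mk fun n => linearCoeff n (x n)

theorem coeff_linearSeries (x : PreLie.Completion) (n : ℕ) :
    PowerSeries.coeff n (linearSeries x) = linearCoeff n (x n) := PowerSeries.coeff_mk _ _

theorem constantCoeff_linearSeries (x : PreLie.Completion) :
    PowerSeries.constantCoeff (linearSeries x) = 0 := by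
  rw [← PowerSeries.coeff_zero_eq_constantCoeff_apply, coeff_linearSeries, ← mk_rep (x 0),
    linearCoeff_mkQ, linearSum_eq_zero_of_isEmpty]

/-- Operations act on the power series by multiplication, up to a constant. -/
theorem linearSeries_actFun {I : Type} [Fintype I] (p : PreLie.obj I) (z : I → PreLie.Completion) :
    linearSeries (actFun p z) = linearSum I p • ∏ i, linearSeries (z i) := by
  classical
  ext N
  rw [coeff_linearSeries, PowerSeries.coeff_smul, PowerSeries.coeff_prod, Finset.smul_sum,
    actFun_apply isOperad p z (Nat.lt_succ_self N), map_sum]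
  have h (n : I → ℕ) : linearCoeff N (cls N (PreLie.comp p fun i => rep (z i (n i)))) =
      if ∑ i, n i = N then linearSum I p * ∏ i, linearCoeff (n i) (z i (n i)) else 0 := by
    rw [linearCoeff_cls, Fintype.card_sigma]
    simp_rw [Fintype.card_fin]
    refine if_congr Iff.rfl ?_ rfl
    rw [linearSum_comp]
    congr 1
    refine Finset.prod_congr rfl fun i _ => ?_
    rw [← linearCoeff_mkQ, mk_rep]
  simp_rw [h]
  rw [← Finset.sum_filter]
  refine Finset.sum_equiv Finsupp.equivFunOnFinite.symm (fun n => ?_) (fun n _ => ?_)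
  · simp only [Finset.mem_filter, Fintype.mem_piFinset, Finset.mem_range, Finset.mem_finsuppAntidiag,
      Finsupp.equivFunOnFinite_symm_apply_apply, Finset.subset_univ, and_true, and_iff_right_iff_imp]
    rintro rfl i
    exact Nat.lt_succ_of_le (Finset.single_le_sum (fun _ _ => Nat.zero_le _) (Finset.mem_univ i))
  · simp [coeff_linearSeries]

theorem hasSubst_linearSeries (x : PreLie.Completion) : PowerSeries.HasSubst (linearSeries x) :=
  PowerSeries.HasSubst.of_constantCoeff_zero' (constantCoeff_linearSeries x)

/-- The product of the completion becomes the composition of power series. -/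
theorem linearSeries_prod (x y : PreLie.Completion) :
    linearSeries (prod x y) = PowerSeries.subst (linearSeries y) (linearSeries x) := by
  ext N
  rw [PowerSeries.coeff_subst' (hasSubst_linearSeries y), coeff_linearSeries,
    finsum_eq_sum_of_support_subset (s := Finset.Icc 1 N),
    prod_apply_of_mkQ isOperad y (fun m => mk_rep (x m)), map_sum]
  · refine Finset.sum_congr rfl fun m _ => ?_
    rw [← coeff_linearSeries (actFun _ _), linearSeries_actFun, PowerSeries.coeff_smul,
      ← linearCoeff_mkQ, mk_rep, coeff_linearSeries, Finset.prod_const, Finset.card_univ,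
      Fintype.card_fin]
  · intro d hd
    rw [Function.mem_support] at hd
    rw [Finset.coe_Icc, Set.mem_Icc]
    by_contra hlt
    rw [not_and_or, not_le, not_le, Nat.lt_one_iff] at hlt
    apply hd
    rcases hlt with rfl | hlt
    · rw [PowerSeries.coeff_zero_eq_constantCoeff_apply, constantCoeff_linearSeries, zero_smul]
    · have := pow_dvd_pow_of_dvd (PowerSeries.X_dvd_iff.mpr (constantCoeff_linearSeries y)) d
      rw [PowerSeries.X_pow_dvd_iff.mp this N hlt, smul_zero]

theorem linearSeries_one : linearSeries PreLie.one = PowerSeries.X := by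
  ext N
  rw [coeff_linearSeries, PowerSeries.coeff_X]
  refine (linearCoeff_cls N PreLie.unit).trans ?_
  rw [Fintype.card_unit, show PreLie.unit = ofTree point from rfl, linearSum_ofTree isLinear_point]
  exact if_congr eq_comm rfl rfl

theorem linearSeries_iter (k : ℕ) : linearSeries (iter k) = PowerSeries.X ^ (k + 1) := by
  induction k with
  | zero => rw [iter, linearSeries_one, pow_one]
  | succ k ih =>
    rw [iter, bracket]
    change linearSeries (act (ofTree edge) ![iter k, PreLie.one]) = _
    rw [act_eq_actFun, linearSeries_actFun, Fin.prod_univ_two, linearSum_ofTree isLinear_edge, one_smul,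
      pow_succ, ← ih, ← linearSeries_one]
    rfl

theorem linearSeries_expStar : linearSeries expStar = PowerSeries.exp ℚ - 1 := by
  ext N
  rw [coeff_linearSeries, expStar, map_sum, map_sub, PowerSeries.coeff_exp, PowerSeries.coeff_one]
  simp_rw [map_smul, ← coeff_linearSeries, linearSeries_iter, PowerSeries.coeff_X_pow]
  cases N with
  | zero => simp
  | succ N =>
    rw [Finset.sum_eq_single N]
    · simp
    · intro k _ hk
      rw [if_neg (by omega), smul_zero]
    · intro h
      exact absurd (Finset.mem_range.mpr (Nat.lt_succ_self N)) h

/-- The only class in degree one is the unit, up to a constant. -/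
theorem apply_one_eq (x : PreLie.Completion) :
    x 1 = PowerSeries.coeff 1 (linearSeries x) • PreLie.one 1 := by
  have key : ∃ c : ℚ, x 1 = c • PreLie.one 1 := by
    classical
    have he : Fintype.card Unit = 1 := Fintype.card_unit
    refine ⟨coeff point (PreLie.map (Fintype.equivFinOfCardEq he).symm (rep (x 1))), ?_⟩
    have h1 : PreLie.map (Fintype.equivFinOfCardEq he).symm (rep (x 1)) =
        coeff point (PreLie.map (Fintype.equivFinOfCardEq he).symm (rep (x 1))) • PreLie.unit := by
      ext T
      rw [eq_point T, map_smul, coeff_unit, smul_eq_mul, mul_one]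
    conv_lhs => rw [← cls_rep (x 1),
      ← cls_map isOperad (Fintype.equivFinOfCardEq he).symm 1 (rep (x 1)), h1,
      ← clsLinear_apply, map_smul, clsLinear_apply]
    rfl
  obtain ⟨c, hc⟩ := key
  rw [coeff_linearSeries, hc, map_smul, ← coeff_linearSeries, linearSeries_one,
    PowerSeries.coeff_one_X, smul_eq_mul, mul_one]

theorem mem_G_of_coeff_one_ne_zero {x : PreLie.Completion}
    (hx : PowerSeries.coeff 1 (linearSeries x) ≠ 0) : x ∈ PreLie.G :=
  mem_G_of_linear_part isOperad hx (apply_one_eq x)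

/-- The coefficient of a linear tree is the sum of the coefficients of all linear trees with the same
number of vertices, since these are isomorphic. -/
theorem treeCoeff_of_isLinear {n : ℕ} {T : LabelledTree (Fin n)} (hT : T.IsLinear)
    (x : PreLie.Coinv n) : treeCoeff T x = linearCoeff n x := by
  classical
  rw [← mk_rep x, linearCoeff_mkQ]
  have h (T' : LabelledTree (Fin n)) :
      (∃ σ : Equiv.Perm (Fin n), T' = T.relabel σ) ↔ T'.IsLinear := by
    constructor
    · rintro ⟨σ, rfl⟩
      exact (isLinear_relabel σ T).mpr hT
    · intro hT'
      obtain ⟨m, rfl⟩ : ∃ m, n = m + 1 := ⟨n - 1, by have := T.root.pos; omega⟩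
      obtain ⟨e, he⟩ := hT.exists_eq_relabel_ladder (Fintype.card_fin _)
      obtain ⟨e', he'⟩ := hT'.exists_eq_relabel_ladder (Fintype.card_fin _)
      refine ⟨e.symm.trans e', ?_⟩
      rw [he, relabel_trans, he', ← Equiv.trans_assoc, Equiv.self_trans_symm, Equiv.refl_trans]
  have ht : (treeSum T : PreLie.obj (Fin n) →ₗ[ℚ] ℚ) = linearSum (Fin n) :=
    Finset.sum_congr (Finset.filter_congr fun T' _ => h T') fun _ _ => rfl
  exact LinearMap.congr_fun ht (rep x)

end PreLie

namespace As

open LabelledTree OperadData PreLie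

/-- The trees that are not linear span an ideal: the composition of the quotient operad is induced by
the composition of trees. -/
theorem quot_comp {I : Type} [Fintype I] {J : I → Type} [∀ i, Fintype (J i)]
    (p : PreLie.obj I) (q : ∀ i, PreLie.obj (J i)) :
    As.comp (quot I p) (fun i => quot (J i) (q i)) = quot _ (PreLie.comp p q) := by
  classical
  have hs {K : Type} [Finite K] (r : PreLie.obj K) (T : LabelledTree K) (hT : T.IsLinear) :
      coeff T (Function.surjInv (Submodule.mkQ_surjective (nonLinear K)) (quot K r)) =
        coeff T r := by
    rw [← sub_eq_zero, ← map_sub]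
    refine (mem_nonLinear_iff _).mp ?_ T hT
    rw [← Submodule.Quotient.mk_eq_zero, Submodule.Quotient.mk_sub, sub_eq_zero]
    exact Function.surjInv_eq (Submodule.mkQ_surjective (nonLinear K)) (quot K r)
  refine sub_eq_zero.mp ((Submodule.Quotient.mk_sub _).symm.trans ?_)
  refine (Submodule.Quotient.mk_eq_zero _).mpr ((mem_nonLinear_iff _).mpr fun U hU => ?_)
  rw [map_sub, sub_eq_zero, coeff_comp, coeff_comp]
  refine Finset.sum_congr rfl fun T _ => Finset.sum_congr rfl fun S _ => ?_
  split_ifs with h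
  · rw [hs _ T (h.isLinear_outer hU)]
    congr 1
    exact Finset.prod_congr rfl fun i _ => hs _ _ (h.isLinear_inner hU i)
  · rfl

/-- The map induced by the quotient map of operads on the coinvariants of degree `n`. -/
def phiCoinv (n : ℕ) : PreLie.Coinv n →ₗ[ℚ] As.Coinv n :=
  Submodule.mapQ _ _ (quot (Fin n)) (coinvKer_le_comap n)

theorem phiCoinv_mkQ {n : ℕ} (p : PreLie.obj (Fin n)) :
    phiCoinv n ((PreLie.coinvKer n).mkQ p) = (As.coinvKer n).mkQ (quot _ p) := rfl

theorem phi_apply (x : PreLie.Completion) (n : ℕ) : phi x n = phiCoinv n (x n) := rfl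

theorem quot_surjective (I : Type) : Function.Surjective (quot I) :=
  Submodule.mkQ_surjective _

theorem phiCoinv_cls {I : Type} [Fintype I] (N : ℕ) (p : PreLie.obj I) :
    phiCoinv N (cls N p) = cls N (quot I p) := by
  unfold cls
  split_ifs
  · rfl
  · exact map_zero _

theorem phi_surjective : Function.Surjective phi := by
  intro z
  have h (n : ℕ) : ∃ c, phiCoinv n c = z n := by
    obtain ⟨a, ha⟩ := quot_surjective _ (rep (z n))
    exact ⟨(PreLie.coinvKer n).mkQ a, by rw [phiCoinv_mkQ, ha, mk_rep]⟩
  choose x hx using h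
  exact ⟨x, funext hx⟩

/-- Every representative of the image of a class of coinvariants lifts to a representative of that
class. -/
theorem exists_lift_rep {n : ℕ} (x : PreLie.Coinv n) :
    ∃ a, (PreLie.coinvKer n).mkQ a = x ∧ quot _ a = rep (phiCoinv n x) := by
  obtain ⟨a, ha⟩ := quot_surjective _ (rep (phiCoinv n x))
  have hle : As.coinvKer n ≤ (PreLie.coinvKer n).map (quot (Fin n)) := by
    rw [OperadData.coinvKer, Submodule.span_le]
    rintro _ ⟨σ, q, rfl⟩
    obtain ⟨q, rfl⟩ := quot_surjective _ q
    exact ⟨PreLie.map σ q - q, Submodule.subset_span ⟨σ, q, rfl⟩, map_sub _ _ _⟩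
  have hmem : quot _ (a - rep x) ∈ As.coinvKer n := by
    rw [map_sub, ← Submodule.Quotient.mk_eq_zero, Submodule.Quotient.mk_sub, sub_eq_zero, ha]
    refine (mk_rep (phiCoinv n x)).trans ?_
    conv_lhs => rw [← mk_rep x]
    rfl
  obtain ⟨k, hk, hka⟩ := hle hmem
  refine ⟨rep x + k, ?_, ?_⟩
  · rw [map_add, mk_rep, Submodule.mkQ_apply _ k, (Submodule.Quotient.mk_eq_zero _).mpr hk, add_zero]
  · rw [map_add, hka, ← map_add, add_sub_cancel, ha]

theorem phi_prod (x y : PreLie.Completion) : phi (prod x y) = prod (phi x) (phi y) := by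
  choose a ha ha' using fun m => exists_lift_rep (x m)
  choose b hb hb' using fun m => exists_lift_rep (y m)
  funext N
  rw [phi_apply, prod_apply_of_mkQ isOperad y ha, map_sum]
  refine Finset.sum_congr rfl fun m _ => ?_
  rw [← act_eq_actFun]
  unfold act
  rw [map_sum]
  refine Finset.sum_congr rfl fun n _ => ?_
  rw [cls_comp_congr isOperad N (a m) _ (fun i => b (n i)) (fun i => by rw [mk_rep, hb]),
    phiCoinv_cls, ← quot_comp]
  simp_rw [ha', hb']
  rfl

theorem phi_one : phi PreLie.one = As.one := by
  funext N
  exact phiCoinv_cls N PreLie.unit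

/-- The laws of the product are inherited from the pre-Lie operad, as `phi` is surjective. -/
theorem isMonoid : As.IsMonoid := by
  refine ⟨fun x y z => ?_, fun x => ?_⟩
  · obtain ⟨x, rfl⟩ := phi_surjective x
    obtain ⟨y, rfl⟩ := phi_surjective y
    obtain ⟨z, rfl⟩ := phi_surjective z
    simp_rw [← phi_prod, isOperad.prod_assoc]
  · obtain ⟨x, rfl⟩ := phi_surjective x
    simp_rw [← phi_one, ← phi_prod, isOperad.one_prod, isOperad.prod_one, and_self]

theorem phi_mem_G {x : PreLie.Completion} (hx : x ∈ PreLie.G) : phi x ∈ As.G := by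
  obtain ⟨y, hxy, hyx⟩ := hx
  exact ⟨phi y, by rw [← phi_prod, hxy, phi_one], by rw [← phi_prod, hyx, phi_one]⟩

/-- The coinvariants of the associative operad are spanned by `θ_n`: all linear trees with `n` vertices
are isomorphic to the standard one, and the other trees vanish. -/
theorem mkQ_quot_eq {n : ℕ} (p : PreLie.obj (Fin n)) :
    (As.coinvKer n).mkQ (quot _ p) = linearSum (Fin n) p • theta n := by
  classical
  cases n with
  | zero => rw [eq_zero_of_isEmpty isOperad p, map_zero, map_zero, map_zero, zero_smul]
  | succ n =>
    rw [linearSum_apply, Finset.sum_smul]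
    conv_lhs => rw [eq_sum_ofTree p]
    rw [map_sum, map_sum]
    refine Finset.sum_congr rfl fun T _ => ?_
    rw [map_smul, map_smul]
    split_ifs with hT
    · congr 1
      obtain ⟨e, rfl⟩ := hT.exists_eq_relabel_ladder (Fintype.card_fin _)
      refine sub_eq_zero.mp ((Submodule.Quotient.mk_sub _).symm.trans
        ((Submodule.Quotient.mk_eq_zero _).mpr (Submodule.subset_span
          ⟨e, quot _ (ofTree (ladder n)), ?_⟩)))
      congr 1
      refine congrArg (quot _) (?_ : ofTree _ = PreLie.map e (ofTree (ladder n)))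
      exact Finsupp.mapDomain_single.symm
    · have : quot (Fin (n + 1)) (ofTree T) = 0 :=
        (Submodule.Quotient.mk_eq_zero _).mpr (Submodule.subset_span ⟨T, hT, rfl⟩)
      rw [this, map_zero, smul_zero, zero_smul]

/-- In the associative operad only the power series counting linear trees remains. -/
theorem phi_eq_ofSeries (x : PreLie.Completion) : phi x = ofSeries (linearSeries x) := by
  funext n
  rw [phi_apply, ofSeries, coeff_linearSeries, ← mk_rep (x n), phiCoinv_mkQ, mkQ_quot_eq,
    linearCoeff_mkQ]

/-- The class of the linear tree is not zero, as the sum of the coefficients of the linear trees descends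
to the coinvariants of the associative operad. -/
theorem theta_succ_ne_zero (n : ℕ) : theta (n + 1) ≠ 0 := by
  let L : As.obj (Fin (n + 1)) →ₗ[ℚ] ℚ := (nonLinear (Fin (n + 1))).liftQ (linearSum _) (by
    classical
    intro p hp
    rw [LinearMap.mem_ker, linearSum_apply]
    refine Finset.sum_eq_zero fun T _ => ?_
    split_ifs with hT
    · exact (mem_nonLinear_iff p).mp hp T hT
    · rfl)
  have hL (p : PreLie.obj (Fin (n + 1))) : L (quot _ p) = linearSum _ p := rfl
  have hle : As.coinvKer (n + 1) ≤ LinearMap.ker L := by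
    rw [OperadData.coinvKer, Submodule.span_le]
    rintro _ ⟨σ, p, rfl⟩
    obtain ⟨p, rfl⟩ := quot_surjective _ p
    change L (As.map σ (quot _ p) - quot _ p) = 0
    rw [map_sub, sub_eq_zero]
    exact linearSum_map σ p
  intro h
  have h0 : L (quot _ (ofTree (ladder n))) = 0 := hle ((Submodule.Quotient.mk_eq_zero _).mp h)
  rw [hL, linearSum_ofTree (isLinear_ladder n)] at h0
  exact one_ne_zero h0

theorem ofSeries_injOn : Set.InjOn ofSeries {f | PowerSeries.constantCoeff f = 0} := by
  intro f hf g hg h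
  ext n
  cases n with
  | zero =>
    rw [PowerSeries.coeff_zero_eq_constantCoeff_apply, PowerSeries.coeff_zero_eq_constantCoeff_apply,
      show PowerSeries.constantCoeff f = 0 from hf, show PowerSeries.constantCoeff g = 0 from hg]
  | succ n => exact smul_left_injective ℚ (theta_succ_ne_zero n) (congrFun h (n + 1))

/-- A power series without constant term counts the linear trees of some element of the completed
free pre-Lie algebra. -/
theorem exists_linearSeries_eq {f : PowerSeries ℚ} (hf : PowerSeries.constantCoeff f = 0) :
    ∃ x, linearSeries x = f := by
  obtain ⟨x, hx⟩ := phi_surjective (ofSeries f)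
  rw [phi_eq_ofSeries] at hx
  exact ⟨x, ofSeries_injOn (constantCoeff_linearSeries x) hf hx⟩

theorem ofSeries_subst {f g : PowerSeries ℚ} (hf : PowerSeries.constantCoeff f = 0)
    (hg : PowerSeries.constantCoeff g = 0) :
    ofSeries (PowerSeries.subst g f) = prod (ofSeries f) (ofSeries g) := by
  obtain ⟨x, rfl⟩ := exists_linearSeries_eq hf
  obtain ⟨y, rfl⟩ := exists_linearSeries_eq hg
  rw [← linearSeries_prod, ← phi_eq_ofSeries, ← phi_eq_ofSeries, ← phi_eq_ofSeries, phi_prod]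

theorem linearSeries_of_phi_eq {x y : PreLie.Completion} (h : phi x = phi y) :
    linearSeries x = linearSeries y := by
  rw [phi_eq_ofSeries, phi_eq_ofSeries] at h
  exact ofSeries_injOn (constantCoeff_linearSeries x) (constantCoeff_linearSeries y) h

theorem coeff_one_linearSeries_prod (x y : PreLie.Completion) :
    PowerSeries.coeff 1 (linearSeries (prod x y)) =
      PowerSeries.coeff 1 (linearSeries x) * PowerSeries.coeff 1 (linearSeries y) := by
  rw [coeff_linearSeries, prod_apply_of_mkQ isOperad y (fun m => mk_rep (x m)), Finset.Icc_self,
    Finset.sum_singleton, ← coeff_linearSeries (actFun _ _), linearSeries_actFun,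
    PowerSeries.coeff_smul, ← linearCoeff_mkQ, mk_rep, coeff_linearSeries x, Fin.prod_univ_one,
    smul_eq_mul]

/-- The invertible elements are those whose power series has a nonzero coefficient in degree one: this
is necessary by multiplicativity of that coefficient, and sufficient because such a series lifts to an
invertible element of the completion of the pre-Lie operad. -/
theorem bijOn_ofSeries : Set.BijOn ofSeries invertibleSeries As.G := by
  refine ⟨?_, ofSeries_injOn.mono fun f hf => hf.1, ?_⟩
  · rintro f ⟨hf0, hf1⟩
    obtain ⟨x, rfl⟩ := exists_linearSeries_eq hf0
    rw [← phi_eq_ofSeries]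
    exact phi_mem_G (mem_G_of_coeff_one_ne_zero hf1)
  · rintro z ⟨w, hzw, -⟩
    obtain ⟨x, rfl⟩ := phi_surjective z
    obtain ⟨y, rfl⟩ := phi_surjective w
    refine ⟨linearSeries x, ⟨constantCoeff_linearSeries x, fun h => ?_⟩, (phi_eq_ofSeries x).symm⟩
    rw [← phi_prod, ← phi_one] at hzw
    have h1 := congrArg (PowerSeries.coeff 1) (linearSeries_of_phi_eq hzw)
    rw [coeff_one_linearSeries_prod, h, zero_mul, linearSeries_one, PowerSeries.coeff_one_X] at h1
    exact zero_ne_one h1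

end As

/-- The series `log (1 + x)` and `exp x - 1` are inverse to each other: the derivative of
`log (1 + (exp x - 1))` is `1`. -/
theorem PowerSeries.subst_exp_sub_one_log :
    PowerSeries.subst (PowerSeries.exp ℚ - 1) (PowerSeries.log ℚ) = PowerSeries.X := by
  have hs : PowerSeries.HasSubst (PowerSeries.exp ℚ - 1) := PowerSeries.HasSubst.exp_sub_one
  have h0 : PowerSeries.constantCoeff (PowerSeries.exp ℚ - 1) = 0 := by
    rw [map_sub, PowerSeries.constantCoeff_exp, map_one, sub_self]
  have hd : (1 + PowerSeries.X) * PowerSeries.derivative ℚ (PowerSeries.log ℚ) = 1 := by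
    rw [PowerSeries.deriv_log]
    ext n
    rw [add_mul, one_mul, map_add, PowerSeries.coeff_one]
    cases n with
    | zero => simp
    | succ n => simp [PowerSeries.coeff_succ_X_mul, pow_succ]
  apply PowerSeries.derivative.ext
  · have h := congrArg (PowerSeries.subst (PowerSeries.exp ℚ - 1)) hd
    rw [PowerSeries.subst_mul hs, PowerSeries.subst_add hs, PowerSeries.subst_X hs,
      ← PowerSeries.coe_substAlgHom hs, map_one, add_sub_cancel] at h
    rw [PowerSeries.derivative_subst hs, map_sub, PowerSeries.derivative_exp,
      PowerSeries.derivative_one, sub_zero, mul_comm, ← PowerSeries.coe_substAlgHom hs, h,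
      PowerSeries.derivative_X]
  · rw [PowerSeries.constantCoeff_X]
    exact PowerSeries.constantCoeff_subst_eq_zero h0 _ PowerSeries.constantCoeff_log

open PreLie in
/-- The power series of an inverse of `exp*` is `log (1 + x)`. -/
theorem PreLie.linearSeries_of_isInverse {L : PreLie.Completion}
    (hL : OperadData.IsInverse PreLie.expStar L) : linearSeries L = PowerSeries.log ℚ := by
  have h := linearSeries_prod expStar L
  rw [hL.1, linearSeries_one, linearSeries_expStar] at h
  have h2 := PowerSeries.subst_comp_subst_apply (R := ℚ) (PowerSeries.HasSubst.exp_sub_one (A := ℚ))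
    (hasSubst_linearSeries L) (PowerSeries.log ℚ)
  rw [PowerSeries.subst_exp_sub_one_log, ← h, PowerSeries.X_subst,
    PowerSeries.subst_X (hasSubst_linearSeries L)] at h2
  exact h2

end

theorem mainTheorem4 :
    (PreLie.IsMonoid ∧ As.IsMonoid) ∧
    (Set.MapsTo As.phi PreLie.G As.G ∧
      ∀ x ∈ PreLie.G, ∀ y ∈ PreLie.G,
        As.phi (OperadData.prod x y) = OperadData.prod (As.phi x) (As.phi y)) ∧
    (Set.BijOn As.ofSeries invertibleSeries As.G ∧
      ∀ f ∈ invertibleSeries, ∀ g ∈ invertibleSeries,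
        As.ofSeries (PowerSeries.subst g f) =
          OperadData.prod (As.ofSeries f) (As.ofSeries g)) ∧
    PreLie.expStar ∈ PreLie.G ∧
    ∃ logStar : PreLie.Completion,
      (∀ L : PreLie.Completion, OperadData.IsInverse PreLie.expStar L ↔ L = logStar) ∧
      As.phi PreLie.expStar = As.ofSeries (PowerSeries.exp ℚ - 1) ∧
      As.phi logStar = As.ofSeries (PowerSeries.log ℚ) ∧
      ∀ (n : ℕ) (T : LabelledTree (Fin n)), T.IsLinear →
        PreLie.treeCoeff T (PreLie.expStar n) = 1 / (Nat.factorial n : ℚ) := by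
  have hexp : PreLie.expStar ∈ PreLie.G := by
    apply PreLie.mem_G_of_coeff_one_ne_zero
    rw [PreLie.linearSeries_expStar]
    simp [PowerSeries.coeff_exp, PowerSeries.coeff_one]
  refine ⟨⟨PreLie.isOperad.isMonoid, As.isMonoid⟩,
    ⟨fun x hx => As.phi_mem_G hx, fun x _ y _ => As.phi_prod x y⟩,
    ⟨As.bijOn_ofSeries, fun f hf g hg => As.ofSeries_subst hf.1 hg.1⟩, hexp, ?_⟩
  obtain ⟨logStar, hlog⟩ := hexp
  refine ⟨logStar, fun L => ⟨fun hL => ?_, fun hL => hL ▸ hlog⟩, ?_, ?_, fun n T hT => ?_⟩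
  · exact PreLie.isOperad.isMonoid.inverse_unique hL.1 hlog.2
  · rw [As.phi_eq_ofSeries, PreLie.linearSeries_expStar]
  · rw [As.phi_eq_ofSeries, PreLie.linearSeries_of_isInverse hlog]
  · have hn : n ≠ 0 := T.root.pos.ne'
    rw [PreLie.treeCoeff_of_isLinear hT, ← PreLie.coeff_linearSeries, PreLie.linearSeries_expStar,
      map_sub, PowerSeries.coeff_exp, PowerSeries.coeff_one, if_neg hn, sub_zero]
    rfl
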